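/- **Theorem (gate self-test).** Let $X=\begin{pmatrix}0&1\\1&0\end{pmatrix}$, $Z=\begin{pmatrix}1&0\\0&-1\end{pmatrix}$, $D=\frac{X+Z}{\sqrt2}$, and let $T$ be either a single-qubit unitary with real matrix entries ($n=1$) or $T=\text{CTRL-}Z$ ($n=2$). Let $\mathcal X_A=\mathcal X_B=(\mathbb C^2)^{\otimes n}$, let $|\phi\rangle\in\mathcal X_A\otimes\mathcal X_B$ be the tensor product of $n$ EPR pairs $\frac{1}{\sqrt2}(|00\rangle+|11\rangle)$, the $w$-th pair being shared by the $w$-th qubits of the two sides, and for $a,b\in\{I,X,Z,D\}^n$ let $M_a$ on $\mathcal X_A$ and $N_b$ on $\mathcal X_B$ be the tensor products of the observables listed in $a$ and $b$ (where $I$ means that the qubit is not measured). The reference experiments are: (1) $|\phi\rangle$, (2) $T\otimes T|\phi\rangle$, (3) $T\otimes I|\phi\rangle$, each measured with all the $M_a\otimes N_b$. Let $\mathcal Y_A=\bigotimes_{w=1}^n\mathcal Y_{A,w}$ and $\mathcal Y_B=\bigotimes_{w=1}^n\mathcal Y_{B,w}$ be finite-dimensional Hilbert spaces of arbitrary dimensions,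 let $|\psi\rangle\in\mathcal Y_A\otimes\mathcal Y_B$ be a unit vector, and let $G'$ on $\mathcal Y_A$ and $H'$ on $\mathcal Y_B$ be unitaries. For every wire $w$ let there be two measurement devices on $\mathcal Y_{A,w}$ and two on $\mathcal Y_{B,w}$, each consisting of one Hermitian observable with square $I$ (values $\pm1$) for each of the settings $I,X,Z,D$, with setting $I$ realized by the identity; let $M'_a,M''_a$ (on $\mathcal Y_A$) and $N'_b,N''_b$ (on $\mathcal Y_B$) be the tensor products over the wires of these observables for settings $a,b\in\{I,X,Z,D\}^n$. The three physical experiments are: 1. $|\psi\rangle$ with measurements $M'_a\otimes N'_b$; 2. $G'\otimes H'|\psi\rangle$ with measurements $M''_a\otimes N''_b$; 3. $G'\otimes I_{\mathcal Y_B}|\psi\rangle$ with measurements $M''_a\otimes N'_b$. Suppose that each physical experiment simulates the reference experiment of the same number, that is, for all settings $a,b$ the joint distribution of the output bits (one bit for each wire of each side) is the same in both. Then there exist unitaries $U_A,V_A$ on $\mathcal Y_A\otimes\mathcal X_A$ and $U_B,V_B$ on $\mathcal Y_B\otimes\mathcal X_B$ and a unit vector $|junk\rangle\in\mathcal Y_A\otimes\mathcal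 Y_B$ such that, for all settings $a,b$ (the setting $I$ everywhere gives the statement for the states alone), $$(U_A\otimes U_B)\big((M'_a\otimes N'_b)|\psi\rangle\otimes|0\cdots0\rangle\big)=|junk\rangle\otimes(M_a\otimes N_b)|\phi\rangle,$$ $$(V_A\otimes V_B)\big((M''_a\otimes N''_b)(G'\otimes H')|\psi\rangle\otimes|0\cdots0\rangle\big)=|junk\rangle\otimes(M_a\otimes N_b)(T\otimes T)|\phi\rangle,$$ $$(V_A\otimes U_B)\big((M''_a\otimes N'_b)(G'\otimes I)|\psi\rangle\otimes|0\cdots0\rangle\big)=|junk\rangle\otimes(M_a\otimes N_b)(T\otimes I)|\phi\rangle,$$ where $|0\cdots0\rangle\in\mathcal X_A\otimes\mathcal X_B$ and tensor factors are reordered as needed; that is, the three physical experiments are equivalent to the corresponding reference experiments with the unitaries $U_A\otimes U_B$, $V_A\otimes V_B$, $V_A\otimes U_B$ and the same junk state. Moreover, $$V_A\,(G'\otimes I_{\mathcal X_A})\,U_A^\dagger\,(|v\rangle\otimes|x\rangle)=|v\rangle\otimes T|x\rangle$$ for all $|x\rangle\in\mathcal X_A$ and all $|v\rangle$ in the support of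 $|junk\rangle$ on $\mathcal Y_A$. -/

import Mathlib

open Matrix
open scoped Kronecker

noncomputable section

namespace GateSelfTest

universe u v

/-- The joint system of `n` wires: if wire `w` carries the finite-dimensional Hilbert space
`ℂ^(ι w)`, then a register carries `⨂ w, ℂ^(ι w) = ℂ^(∀ w, ι w)`. -/
abbrev Reg {n : ℕ} (ι : Fin n → Type u) : Type u := ∀ w, ι w

/-- Basis labels of `n` qubits. -/
abbrev Qubits (n : ℕ) : Type := Reg (fun _ : Fin n => Fin 2)

/-- The measurement settings of a single wire.  `I` stands for not measuring the wire. -/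
inductive Setting : Type
  | I | X | Z | D

/-- A measurement device for one wire: for each setting an observable with values `±1`
(one bit of output), the setting `I` being the trivial measurement. -/
structure MeasDevice (ι : Type u) [Fintype ι] [DecidableEq ι] where
  obs : Setting → Matrix ι ι ℂ
  isHermitian : ∀ s, (obs s).IsHermitian
  sq_eq_one : ∀ s, obs s * obs s = 1
  obs_I : obs Setting.I = 1

/-- The projection onto the eigenspace of the observable of setting `s` for the eigenvalue
`(-1)^x`, where `x` is the output bit. -/
def MeasDevice.proj {ι : Type u} [Fintype ι] [DecidableEq ι] (M : MeasDevice ι)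
    (s : Setting) (x : Fin 2) : Matrix ι ι ℂ :=
  (1 / 2 : ℂ) • (1 + ((-1 : ℂ) ^ (x : ℕ)) • M.obs s)

/-- The tensor product `⨂ w, M w` of one operator per wire. -/
def tensorOp {n : ℕ} {ι : Fin n → Type u} (M : ∀ w, Matrix (ι w) (ι w) ℂ) :
    Matrix (Reg ι) (Reg ι) ℂ :=
  Matrix.of fun x y => ∏ w, M w (x w) (y w)

/-- A bipartite experiment with `n` wires on either side: a vector shared by the two sides and
one measurement device for each wire. -/
structure Experiment {n : ℕ} (ιA : Fin n → Type u) (ιB : Fin n → Type v)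
    [∀ w, Fintype (ιA w)] [∀ w, DecidableEq (ιA w)]
    [∀ w, Fintype (ιB w)] [∀ w, DecidableEq (ιB w)] where
  state : Reg ιA × Reg ιB → ℂ
  measA : ∀ w, MeasDevice (ιA w)
  measB : ∀ w, MeasDevice (ιB w)

section Experiments

variable {n : ℕ} {ιA : Fin n → Type u} {ιB : Fin n → Type v}
  [∀ w, Fintype (ιA w)] [∀ w, DecidableEq (ιA w)]
  [∀ w, Fintype (ιB w)] [∀ w, DecidableEq (ιB w)]

/-- The observable `M_a ⊗ N_b`, where `M_a` and `N_b` are the tensor products of the observables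
of the single wires for the settings `a` and `b`. -/
def Experiment.obs (E : Experiment ιA ιB) (a b : Fin n → Setting) :
    Matrix (Reg ιA × Reg ιB) (Reg ιA × Reg ιB) ℂ :=
  tensorOp (fun w => (E.measA w).obs (a w)) ⊗ₖ tensorOp (fun w => (E.measB w).obs (b w))

/-- The statistics of the experiment: the probability `p(x, y | a, b)` of the output bits `x` on
side `A` and `y` on side `B`, given the settings `a` and `b`. -/
def Experiment.prob (E : Experiment ιA ιB) (a b : Fin n → Setting) (x y : Fin n → Fin 2) : ℝ :=
  (star E.state ⬝ᵥ
    ((tensorOp (fun w => (E.measA w).proj (a w) (x w)) ⊗ₖ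
      tensorOp (fun w => (E.measB w).proj (b w) (y w))) *ᵥ E.state)).re

/-- A physical experiment simulates a reference experiment on qubits if it generates the same
statistics. -/
def Experiment.Simulates (E : Experiment ιA ιB)
    (R : Experiment (fun _ : Fin n => Fin 2) (fun _ : Fin n => Fin 2)) : Prop :=
  ∀ (a b : Fin n → Setting) (x y : Fin n → Fin 2), E.prob a b x y = R.prob a b x y

end Experiments

/-- The vector is a (normalized) pure state. -/
def IsState {κ : Type u} [Fintype κ] (ψ : κ → ℂ) : Prop := ∑ k, ‖ψ k‖ ^ 2 = 1

/-- Attaching an ancilla of `n` qubits in the state `|0…0⟩`: the isometry `v ↦ v ⊗ |0…0⟩`. -/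
def ancilla (κ : Type u) [DecidableEq κ] (n : ℕ) : Matrix (κ × Qubits n) κ ℂ :=
  Matrix.of fun p k => if p.1 = k ∧ p.2 = 0 then 1 else 0

/-- The vector `junk ⊗ φ`, with the tensor factors `(Y_A ⊗ Y_B) ⊗ (X_A ⊗ X_B)` sorted as
`(Y_A ⊗ X_A) ⊗ (Y_B ⊗ X_B)`. -/
def junkTensor {α : Type u} {β : Type v} {n : ℕ} (junk : α × β → ℂ)
    (φ : Qubits n × Qubits n → ℂ) : (α × Qubits n) × (β × Qubits n) → ℂ :=
  fun p => junk (p.1.1, p.2.1) * φ (p.1.2, p.2.2)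

section Equivalence

variable {n : ℕ} {ιA : Fin n → Type u} {ιB : Fin n → Type v}
  [∀ w, Fintype (ιA w)] [∀ w, DecidableEq (ιA w)]
  [∀ w, Fintype (ιB w)] [∀ w, DecidableEq (ιB w)]

/-- The physical experiment `E` is equivalent to the reference experiment `R` through the local
isometry `ΦA ⊗ ΦB`, `Φj : Y_j → Y_j ⊗ X_j`, with the given junk state:
`Φ ψ' = junk ⊗ ψ` and `Φ (M'_a ⊗ N'_b) ψ' = junk ⊗ (M_a ⊗ N_b) ψ` for all settings. -/
structure Experiment.EquivalentVia (E : Experiment ιA ιB)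
    (R : Experiment (fun _ : Fin n => Fin 2) (fun _ : Fin n => Fin 2))
    (ΦA : Matrix (Reg ιA × Qubits n) (Reg ιA) ℂ) (ΦB : Matrix (Reg ιB × Qubits n) (Reg ιB) ℂ)
    (junk : Reg ιA × Reg ιB → ℂ) : Prop where
  isometryA : ΦAᴴ * ΦA = 1
  isometryB : ΦBᴴ * ΦB = 1
  map_state : (ΦA ⊗ₖ ΦB) *ᵥ E.state = junkTensor junk R.state
  map_meas : ∀ a b : Fin n → Setting,
    (ΦA ⊗ₖ ΦB) *ᵥ (E.obs a b *ᵥ E.state) = junkTensor junk (R.obs a b *ᵥ R.state)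

/-- Equivalence with the local unitaries `UA ⊗ UB`: the local isometry attaches ancillae
`|0…0⟩` on both sides and applies `UA ⊗ UB`. -/
def Experiment.EquivalentWith (E : Experiment ιA ιB)
    (R : Experiment (fun _ : Fin n => Fin 2) (fun _ : Fin n => Fin 2))
    (UA : Matrix (Reg ιA × Qubits n) (Reg ιA × Qubits n) ℂ)
    (UB : Matrix (Reg ιB × Qubits n) (Reg ιB × Qubits n) ℂ)
    (junk : Reg ιA × Reg ιB → ℂ) : Prop :=
  E.EquivalentVia R (UA * ancilla (Reg ιA) n) (UB * ancilla (Reg ιB) n) junk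

end Equivalence

/-- The support of a bipartite vector on the system `A`: the span of its partial contractions with
the basis vectors of `B`, that is, the smallest subspace `S` with `χ ∈ S ⊗ B`. -/
def supportA {α : Type u} {β : Type v} (χ : α × β → ℂ) : Submodule ℂ (α → ℂ) :=
  Submodule.span ℂ (Set.range fun b : β => fun a : α => χ (a, b))

/-- The product vector `v ⊗ w`. -/
def tensorVec {α : Type u} {β : Type v} (v : α → ℂ) (w : β → ℂ) : α × β → ℂ :=
  fun p => v p.1 * w p.2

/-- The reference observables `I`, `X`, `Z` and `D = (X + Z) / √2` of a qubit. -/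
def refObs : Setting → Matrix (Fin 2) (Fin 2) ℂ
  | .I => 1
  | .X => !![0, 1; 1, 0]
  | .Z => !![1, 0; 0, -1]
  | .D => (1 / (Real.sqrt 2 : ℂ)) • (!![0, 1; 1, 0] + !![1, 0; 0, -1])

theorem inv_sqrt_two_mul_self :
    (1 / (Real.sqrt 2 : ℂ)) * (1 / (Real.sqrt 2 : ℂ)) = 1 / 2 := by
  rw [div_mul_div_comm, ← Complex.ofReal_mul, Real.mul_self_sqrt (by norm_num)]
  norm_num

/-- The reference measurement device for one qubit. -/
def refDevice : MeasDevice (Fin 2) where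
  obs := refObs
  isHermitian := by
    intro s
    cases s <;> ext i j <;> fin_cases i <;> fin_cases j <;> simp [refObs]
  sq_eq_one := by
    intro s
    cases s
    case D =>
      simp only [refObs]
      rw [smul_mul_smul_comm, inv_sqrt_two_mul_self]
      ext i j
      fin_cases i <;> fin_cases j <;> simp [Matrix.mul_apply, Fin.sum_univ_two] <;> norm_num
    all_goals
      ext i j
      fin_cases i <;> fin_cases j <;> simp [refObs, Matrix.mul_apply, Fin.sum_univ_two]
  obs_I := rfl

/-- The EPR pair `(|00⟩ + |11⟩) / √2`. -/
def eprPair (i j : Fin 2) : ℂ := if i = j then 1 / (Real.sqrt 2 : ℂ) else 0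

/-- The tensor product of `n` EPR pairs, the `w`-th pair being shared by the `w`-th qubit of side
`A` and the `w`-th qubit of side `B`. -/
def refState (n : ℕ) : Qubits n × Qubits n → ℂ := fun p => ∏ w, eprPair (p.1 w) (p.2 w)

/-- The controlled phase flip `CTRL-Z` on two qubits. -/
def ctrlZ : Matrix (Qubits 2) (Qubits 2) ℂ :=
  Matrix.diagonal fun x => if x 0 = 1 ∧ x 1 = 1 then -1 else 1

/-- The reference gates: the real unitaries of a single qubit, and `CTRL-Z`. -/
inductive IsReferenceGate : (n : ℕ) → Matrix (Qubits n) (Qubits n) ℂ → Prop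
  | realQubit (T : Matrix (Qubits 1) (Qubits 1) ℂ) (isUnitary : T ∈ Matrix.unitaryGroup (Qubits 1) ℂ)
      (isReal : ∀ x y, (T x y).im = 0) : IsReferenceGate 1 T
  | ctrlZ : IsReferenceGate 2 GateSelfTest.ctrlZ

/-- The reference experiment in which the gates `S` and `T` are applied to the `A` and `B` sides of
`n` EPR pairs, which are then measured. -/
def refExperiment {n : ℕ} (S T : Matrix (Qubits n) (Qubits n) ℂ) :
    Experiment (fun _ : Fin n => Fin 2) (fun _ : Fin n => Fin 2) where
  state := (S ⊗ₖ T) *ᵥ refState n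
  measA := fun _ => refDevice
  measB := fun _ => refDevice

end GateSelfTest

end

open GateSelfTest

/-!
Local isometries that identify a gate up to the junk system.

A bipartite vector `ψ ∈ Y_A ⊗ Y_B` is treated as a matrix `Ψ` (`asMatrix`), so that
`(A ⊗ B) ψ` becomes `A Ψ Bᵀ` and `n` EPR pairs become a multiple of the identity matrix. An operator
identity on the support of `ψ` on side `A` is then an identity between matrices of the form `A Ψ`.

*EPR pairs.* Equal statistics mean equal correlations `Re ⟨ψ, (M_a ⊗ N_b) ψ⟩`. Equality in the
Cauchy–Schwarz inequality turns perfect correlation into `M_a Ψ = Ψ N_aᵀ`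
(`HasEPRCorr.mul_eq_mul_transpose`) and the correlations of `D` with the orthogonal vectors `X ψ`,
`Z ψ` into `D ψ = (X ψ + Z ψ) / √2`; from `D² = 1` it follows that `X` and `Z` anticommute on `ψ`
(`HasEPRCorr.pauliRelations`). The map `Φ v = ∑ x, X ^ x P x v ⊗ |x⟩`, with `P x` the projections
of the setting `Z`, is an isometry for any devices, and by these relations it carries the
observables of the devices, applied to `ψ`, to the reference observables
(`HasEPRCorr.swapIsometry_mul`). Hence the image of `ψ` under the isometries of the two sides is a
matrix that commutes with `1 ⊗ X_w` and `1 ⊗ Z_w` for all wires `w`, that is, `J ⊗ 1`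
(`exists_eq_kronecker_one`), which is a junk vector times EPR pairs.

*The gate.* Since `T` is real and unitary, `T ⊗ T` leaves the EPR pairs invariant, and the above
applies to the first and to the second experiment. For `R` one of the observables `X_w`, `Z_w`,
the matrix `Tᴴ R T` is a real combination of the reference observables
(`IsReferenceGate.isAdmissibleGate`); for `CTRL-Z` it is even a single one. The third experiment
therefore determines the correlation of the second device on side `A` with the corresponding
combination on side `B`, which is again perfect; so the image of `(G ⊗ 1) ψ`, multiplied by
`1 ⊗ Tᴴ`, commutes with `1 ⊗ X_w` and `1 ⊗ Z_w` and is of the form `J₃ ⊗ 1`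
(`HasEPRCorr.exists_junk_gate`).

*Alignment.* The three junk matrices arise from the same `Ψ` by isometries, so they have equal
Gram matrices and differ by unitaries on the junk systems (`exists_unitary_mul_eq`), which are
absorbed into the isometries of the second devices (`exists_aligned_isometries`). An isometry is a
unitary after an ancilla (`exists_unitary_mul_ancilla`). Finally, comparing `(Φ_A ⊗ Φ_B) ψ = J ⊗ 1`
with `(Φ_A' ⊗ Φ_B) (G ⊗ 1) ψ = J ⊗ T` gives the action of the gate on the support of the junk.
-/

namespace GateSelfTest

universe u v

/-! ### Tensor products of operators over the wires -/

section TensorOp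

variable {n : ℕ} {ι : Fin n → Type u} [∀ w, Fintype (ι w)] [∀ w, DecidableEq (ι w)]

omit [∀ w, DecidableEq (ι w)] in
theorem tensorOp_mul (M N : ∀ w, Matrix (ι w) (ι w) ℂ) :
    tensorOp M * tensorOp N = tensorOp fun w => M w * N w := by
  ext x y
  simp only [tensorOp, Matrix.mul_apply, Matrix.of_apply, ← Finset.prod_mul_distrib]
  rw [Finset.prod_univ_sum, Fintype.piFinset_univ]

omit [∀ w, Fintype (ι w)] in
theorem tensorOp_one : tensorOp (fun w => (1 : Matrix (ι w) (ι w) ℂ)) = 1 := by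
  ext x y
  simp only [tensorOp, Matrix.of_apply, Matrix.one_apply, Finset.prod_ite_zero,
    Finset.prod_const_one, Finset.mem_univ, true_implies, funext_iff]

omit [∀ w, Fintype (ι w)] [∀ w, DecidableEq (ι w)] in
theorem tensorOp_conjTranspose (M : ∀ w, Matrix (ι w) (ι w) ℂ) :
    (tensorOp M)ᴴ = tensorOp fun w => (M w)ᴴ := by
  ext x y
  simp [tensorOp, Matrix.conjTranspose_apply, star_prod]

omit [∀ w, Fintype (ι w)] [∀ w, DecidableEq (ι w)] in
theorem tensorOp_transpose (M : ∀ w, Matrix (ι w) (ι w) ℂ) :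
    (tensorOp M)ᵀ = tensorOp fun w => (M w)ᵀ := rfl

omit [∀ w, DecidableEq (ι w)] in
theorem trace_tensorOp (M : ∀ w, Matrix (ι w) (ι w) ℂ) :
    (tensorOp M).trace = ∏ w, (M w).trace := by
  simp only [Matrix.trace, Matrix.diag, tensorOp, Matrix.of_apply]
  rw [Finset.prod_univ_sum, Fintype.piFinset_univ]

omit [∀ w, Fintype (ι w)] [∀ w, DecidableEq (ι w)] in
/-- Distributivity: the tensor product of sums, one sum of two terms for each wire. -/
theorem sum_tensorOp (P : ∀ w, Fin 2 → Matrix (ι w) (ι w) ℂ) :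
    ∑ x : Qubits n, tensorOp (fun w => P w (x w)) = tensorOp fun w => ∑ i, P w i := by
  ext x y
  simp only [tensorOp, Matrix.sum_apply, Matrix.of_apply]
  rw [Finset.prod_univ_sum, Fintype.piFinset_univ]

omit [∀ w, Fintype (ι w)] [∀ w, DecidableEq (ι w)] in
theorem tensorOp_smul (c : Fin n → ℂ) (M : ∀ w, Matrix (ι w) (ι w) ℂ) :
    tensorOp (fun w => c w • M w) = (∏ w, c w) • tensorOp M := by
  ext x y
  simp [tensorOp, Finset.prod_mul_distrib]

omit [∀ w, Fintype (ι w)] [∀ w, DecidableEq (ι w)] in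
theorem tensorOp_update_apply (M : ∀ w, Matrix (ι w) (ι w) ℂ) (w : Fin n)
    (m : Matrix (ι w) (ι w) ℂ) (x y : Reg ι) :
    tensorOp (Function.update M w m) x y =
      m (x w) (y w) * ∏ v ∈ Finset.univ.erase w, M v (x v) (y v) := by
  rw [tensorOp, Matrix.of_apply, ← Finset.mul_prod_erase _ _ (Finset.mem_univ w)]
  congr 1
  · simp
  · refine Finset.prod_congr rfl fun v hv => ?_
    rw [Function.update_of_ne (Finset.ne_of_mem_erase hv)]

omit [∀ w, Fintype (ι w)] [∀ w, DecidableEq (ι w)] in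
theorem tensorOp_update_add (M : ∀ w, Matrix (ι w) (ι w) ℂ) (w : Fin n)
    (m m' : Matrix (ι w) (ι w) ℂ) :
    tensorOp (Function.update M w (m + m')) =
      tensorOp (Function.update M w m) + tensorOp (Function.update M w m') := by
  ext x y
  simp only [Matrix.add_apply, tensorOp_update_apply, add_mul]

omit [∀ w, Fintype (ι w)] [∀ w, DecidableEq (ι w)] in
theorem tensorOp_update_smul (M : ∀ w, Matrix (ι w) (ι w) ℂ) (w : Fin n) (c : ℂ)
    (m : Matrix (ι w) (ι w) ℂ) :
    tensorOp (Function.update M w (c • m)) = c • tensorOp (Function.update M w m) := by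
  ext x y
  simp only [Matrix.smul_apply, tensorOp_update_apply, smul_eq_mul, mul_assoc]

/-- The operator that acts as `m` on the wire `w` and as the identity on all other wires. -/
noncomputable def wireOp (w : Fin n) (m : Matrix (ι w) (ι w) ℂ) : Matrix (Reg ι) (Reg ι) ℂ :=
  tensorOp (Function.update (fun _ => 1) w m)

theorem tensorOp_update_mul_wireOp (M : ∀ w, Matrix (ι w) (ι w) ℂ) (w : Fin n)
    (c m : Matrix (ι w) (ι w) ℂ) :
    tensorOp (Function.update M w c) * wireOp w m = tensorOp (Function.update M w (c * m)) := by
  rw [wireOp, tensorOp_mul]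
  congr 1
  ext1 v
  rcases eq_or_ne v w with rfl | h
  · simp
  · simp [h]

theorem wireOp_mul_tensorOp_update (M : ∀ w, Matrix (ι w) (ι w) ℂ) (w : Fin n)
    (c m : Matrix (ι w) (ι w) ℂ) :
    wireOp w m * tensorOp (Function.update M w c) = tensorOp (Function.update M w (m * c)) := by
  rw [wireOp, tensorOp_mul]
  congr 1
  ext1 v
  rcases eq_or_ne v w with rfl | h
  · simp
  · simp [h]

theorem tensorOp_mul_wireOp (M : ∀ w, Matrix (ι w) (ι w) ℂ) (w : Fin n)
    (m : Matrix (ι w) (ι w) ℂ) :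
    tensorOp M * wireOp w m = tensorOp (Function.update M w (M w * m)) := by
  rw [← tensorOp_update_mul_wireOp, Function.update_eq_self]

theorem wireOp_mul (w : Fin n) (m m' : Matrix (ι w) (ι w) ℂ) :
    wireOp w (m * m') = wireOp w m * wireOp w m' :=
  (tensorOp_update_mul_wireOp _ w m m').symm

omit [∀ w, Fintype (ι w)] in
theorem wireOp_add (w : Fin n) (m m' : Matrix (ι w) (ι w) ℂ) :
    wireOp w (m + m') = wireOp w m + wireOp w m' := tensorOp_update_add _ w m m'

omit [∀ w, Fintype (ι w)] in
theorem wireOp_smul (w : Fin n) (c : ℂ) (m : Matrix (ι w) (ι w) ℂ) :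
    wireOp w (c • m) = c • wireOp w m := tensorOp_update_smul _ w c m

omit [∀ w, Fintype (ι w)] in
theorem wireOp_sub (w : Fin n) (m m' : Matrix (ι w) (ι w) ℂ) :
    wireOp w (m - m') = wireOp w m - wireOp w m' := by
  rw [eq_sub_iff_add_eq, ← wireOp_add, sub_add_cancel]

theorem wireOp_apply (w : Fin n) (m : Matrix (ι w) (ι w) ℂ) (x y : Reg ι) :
    wireOp w m x y = ∑ i, if y = Function.update x w i then m (x w) i else 0 := by
  rw [wireOp, tensorOp_update_apply, Finset.sum_eq_single (y w)]
  · simp only [Matrix.one_apply, Finset.prod_ite_zero, Finset.prod_const_one, mul_ite, mul_one,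
      mul_zero, Function.eq_update_iff, true_and, Finset.mem_erase, Finset.mem_univ, and_true]
    refine if_congr ?_ rfl rfl
    exact forall₂_congr fun _ _ => eq_comm
  · intro i _ hi
    rw [if_neg]
    rintro h
    exact hi (by rw [h]; simp)
  · simp

/-- The joint observable of the wires for the settings `a`. -/
noncomputable def jointObs (M : ∀ w, MeasDevice (ι w)) (a : Fin n → Setting) :
    Matrix (Reg ι) (Reg ι) ℂ :=
  tensorOp fun w => (M w).obs (a w)

/-- The settings that measure only the wire `w`. -/
def single (w : Fin n) (s : Setting) : Fin n → Setting :=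
  Function.update (fun _ => Setting.I) w s

theorem jointObs_conjTranspose (M : ∀ w, MeasDevice (ι w)) (a : Fin n → Setting) :
    (jointObs M a)ᴴ = jointObs M a := by
  rw [jointObs, tensorOp_conjTranspose]
  congr 1
  ext1 w
  exact (M w).isHermitian _

theorem jointObs_mul_self (M : ∀ w, MeasDevice (ι w)) (a : Fin n → Setting) :
    jointObs M a * jointObs M a = 1 := by
  simp only [jointObs, tensorOp_mul, MeasDevice.sq_eq_one, tensorOp_one]

theorem jointObs_I (M : ∀ w, MeasDevice (ι w)) : jointObs M (fun _ => Setting.I) = 1 := by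
  simp only [jointObs, MeasDevice.obs_I, tensorOp_one]

theorem jointObs_single (M : ∀ w, MeasDevice (ι w)) (w : Fin n) (s : Setting) :
    jointObs M (single w s) = wireOp w ((M w).obs s) := by
  rw [jointObs, wireOp]
  congr 1
  ext1 v
  rcases eq_or_ne v w with rfl | h
  · simp [single]
  · simp [single, h, MeasDevice.obs_I]

theorem jointObs_update (M : ∀ w, MeasDevice (ι w)) (a : Fin n → Setting) (w : Fin n)
    (s : Setting) (ha : a w = Setting.I) :
    jointObs M (Function.update a w s) = wireOp w ((M w).obs s) * jointObs M a := by
  have h : (fun v => (M v).obs (a v)) =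
      Function.update (fun v => (M v).obs (a v)) w 1 := by
    rw [eq_comm, Function.update_eq_iff]
    exact ⟨by rw [ha, MeasDevice.obs_I], fun _ _ => rfl⟩
  rw [jointObs, jointObs, h, wireOp_mul_tensorOp_update, mul_one]
  congr 1
  ext1 v
  rcases eq_or_ne v w with rfl | h
  · simp
  · simp [h]

end TensorOp

/-! ### Bipartite vectors as matrices -/

section Frob

variable {α β γ : Type*} [Fintype α] [Fintype β] [Fintype γ]

/-- A bipartite vector as a matrix with the rows indexed by the basis of `A` and the columns by
the basis of `B`. -/
def asMatrix {α β : Type*} (ψ : α × β → ℂ) : Matrix α β ℂ := Matrix.of fun i j => ψ (i, j)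

omit [Fintype α] [Fintype β] in
theorem asMatrix_injective : Function.Injective (asMatrix (α := α) (β := β)) := by
  intro ψ χ h
  ext ⟨i, j⟩
  exact congrFun (congrFun h i) j

theorem asMatrix_kronecker_mulVec {α' β' : Type*} (A : Matrix α' α ℂ) (B : Matrix β' β ℂ)
    (ψ : α × β → ℂ) : asMatrix ((A ⊗ₖ B) *ᵥ ψ) = A * asMatrix ψ * Bᵀ := by
  ext i j
  simp only [asMatrix, Matrix.mulVec, dotProduct, Matrix.of_apply, Matrix.mul_apply,
    Matrix.kroneckerMap_apply, Matrix.transpose_apply, Fintype.sum_prod_type, Finset.sum_mul]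
  rw [Finset.sum_comm]
  exact Finset.sum_congr rfl fun _ _ => Finset.sum_congr rfl fun _ _ => by ring

/-- The real part of the Frobenius inner product of two matrices, that is, of the inner product
of the corresponding bipartite vectors. -/
noncomputable def frob (A B : Matrix α β ℂ) : ℝ := (Aᴴ * B).trace.re

theorem frob_asMatrix (ψ χ : α × β → ℂ) :
    frob (asMatrix ψ) (asMatrix χ) = (star ψ ⬝ᵥ χ).re := by
  simp only [frob, asMatrix, Matrix.trace, Matrix.diag, Matrix.mul_apply, dotProduct,
    Matrix.conjTranspose_apply, Matrix.of_apply, Fintype.sum_prod_type, Pi.star_apply]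
  rw [Finset.sum_comm]

theorem frob_comm (A B : Matrix α β ℂ) : frob A B = frob B A := by
  rw [frob, frob, ← Matrix.conjTranspose_conjTranspose A, ← Matrix.conjTranspose_mul,
    Matrix.trace_conjTranspose, Matrix.conjTranspose_conjTranspose]
  simp

theorem frob_add_right (A B C : Matrix α β ℂ) : frob A (B + C) = frob A B + frob A C := by
  simp [frob, Matrix.mul_add]

theorem frob_smul_right (c : ℝ) (A B : Matrix α β ℂ) :
    frob A ((c : ℂ) • B) = c * frob A B := by
  simp [frob]

theorem frob_sum_right {κ : Type*} (s : Finset κ) (A : Matrix α β ℂ) (B : κ → Matrix α β ℂ) :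
    frob A (∑ k ∈ s, B k) = ∑ k ∈ s, frob A (B k) := by
  simp [frob, Matrix.mul_sum, Matrix.trace_sum]

theorem frob_add_left (A B C : Matrix α β ℂ) : frob (A + B) C = frob A C + frob B C := by
  simp only [frob_comm _ C, frob_add_right]

theorem frob_smul_left (c : ℝ) (A B : Matrix α β ℂ) :
    frob ((c : ℂ) • A) B = c * frob A B := by
  simp only [frob_comm _ B, frob_smul_right]

theorem frob_self_eq_sum (ψ : α × β → ℂ) :
    frob (asMatrix ψ) (asMatrix ψ) = ∑ k, ‖ψ k‖ ^ 2 := by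
  rw [frob_asMatrix, dotProduct, Complex.re_sum]
  refine Finset.sum_congr rfl fun k _ => ?_
  rw [Pi.star_apply, Complex.star_def, ← Complex.normSq_eq_conj_mul_self, Complex.ofReal_re,
    Complex.normSq_eq_norm_sq]

/-- Equality in the Cauchy–Schwarz inequality: two unit vectors with inner product `1` agree. -/
theorem eq_of_frob_eq_one {A B : Matrix α β ℂ} (hA : frob A A = 1) (hB : frob B B = 1)
    (hAB : frob A B = 1) : A = B := by
  have h : frob (A + ((-1 : ℝ) : ℂ) • B) (A + ((-1 : ℝ) : ℂ) • B) = 0 := by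
    simp only [frob_add_left, frob_add_right, frob_smul_left, frob_smul_right, frob_comm B A,
      hA, hB, hAB]
    norm_num
  let χ : α × β → ℂ := fun p => A p.1 p.2 - B p.1 p.2
  have hχ : A + ((-1 : ℝ) : ℂ) • B = asMatrix χ := by
    ext i j
    simp [χ, asMatrix, sub_eq_add_neg]
  rw [hχ, frob_self_eq_sum, Finset.sum_eq_zero_iff_of_nonneg fun _ _ => by positivity] at h
  ext i j
  simpa [χ, sub_eq_zero] using h (i, j) (Finset.mem_univ _)

theorem frob_isometry_mul [DecidableEq α] {U : Matrix γ α ℂ} (hU : Uᴴ * U = 1)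
    (A B : Matrix α β ℂ) : frob (U * A) (U * B) = frob A B := by
  rw [frob, frob, Matrix.conjTranspose_mul, Matrix.mul_assoc, ← Matrix.mul_assoc Uᴴ, hU,
    Matrix.one_mul]

omit [Fintype β] in
/-- An isometry on the second tensor factor multiplies from the right by its transpose. -/
theorem transpose_mul_conjTranspose_transpose [DecidableEq β] {U : Matrix γ β ℂ}
    (hU : Uᴴ * U = 1) : Uᵀ * Uᵀᴴ = 1 := by
  rw [show Uᵀᴴ = Uᴴᵀ from rfl, ← Matrix.transpose_mul, hU, Matrix.transpose_one]

theorem frob_mul_transpose_isometry [DecidableEq β] {U : Matrix γ β ℂ} (hU : Uᴴ * U = 1)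
    (A B : Matrix α β ℂ) : frob (A * Uᵀ) (B * Uᵀ) = frob A B := by
  rw [frob, frob, Matrix.conjTranspose_mul, Matrix.mul_assoc, Matrix.trace_mul_comm]
  congr 2
  rw [Matrix.mul_assoc, Matrix.mul_assoc, transpose_mul_conjTranspose_transpose hU,
    Matrix.mul_one]

theorem frob_mul_left (U : Matrix α α ℂ) (A B : Matrix α β ℂ) :
    frob (U * A) B = frob A (Uᴴ * B) := by
  rw [frob, frob, Matrix.conjTranspose_mul, Matrix.mul_assoc]

theorem frob_transpose (A B : Matrix α β ℂ) : frob Aᵀ Bᵀ = frob A B := by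
  rw [frob, frob, show Aᵀᴴ = Aᴴᵀ from rfl, ← Matrix.transpose_mul, Matrix.trace_transpose,
    Matrix.trace_mul_comm]

end Frob

/-! ### Isometries of finite-dimensional Hilbert spaces -/

section Polar

variable {β γ : Type*} [Fintype β] [Fintype γ] [DecidableEq β] [DecidableEq γ]

/-- Matrices with the same Gram matrix differ by a unitary: `B v ↦ A v` is a well-defined isometry
on the range of `B`, and it extends to the whole space. -/
theorem exists_unitary_mul_eq {A B : Matrix γ β ℂ} (h : Aᴴ * A = Bᴴ * B) :
    ∃ U ∈ Matrix.unitaryGroup γ ℂ, A = U * B := by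
  let fA := Matrix.toEuclideanLin A
  let fB := Matrix.toEuclideanLin B
  have hnorm : ∀ v, ‖fA v‖ = ‖fB v‖ := by
    intro v
    have key : ∀ C : Matrix γ β ℂ, ‖Matrix.toEuclideanLin C v‖ ^ 2 =
        (inner ℂ v (Matrix.toEuclideanLin (Cᴴ * C) v)).re := by
      intro C
      rw [Matrix.toLpLin_mul_same, LinearMap.comp_apply,
        Matrix.toEuclideanLin_conjTranspose_eq_adjoint, LinearMap.adjoint_inner_right, inner_self_eq_norm_sq_to_K]
      norm_cast
    have := (key A).trans ((by rw [h] : _ = _).trans (key B).symm)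
    exact (sq_eq_sq₀ (norm_nonneg _) (norm_nonneg _)).1 this
  obtain ⟨g, hg⟩ := fB.rangeRestrict.exists_rightInverse_of_surjective fB.range_rangeRestrict
  have hBg : ∀ y, fB (g y) = y := fun y => congrArg Subtype.val (LinearMap.congr_fun hg y)
  let L : LinearMap.range fB →ₗᵢ[ℂ] EuclideanSpace ℂ γ :=
    { toLinearMap := fA ∘ₗ g
      norm_map' := fun y => by
        rw [LinearMap.comp_apply, hnorm, hBg]
        rfl }
  have hLB : ∀ v, L.extend (fB v) = fA v := by
    intro v
    rw [LinearIsometry.extend_apply L ⟨fB v, LinearMap.mem_range_self fB v⟩]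
    change fA (g _) = fA v
    rw [← sub_eq_zero, ← map_sub, ← norm_eq_zero, hnorm, map_sub, hBg, sub_self, norm_zero]
  let U : Matrix γ γ ℂ := Matrix.toEuclideanLin.symm L.extend.toLinearMap
  have hU : Matrix.toEuclideanLin U = L.extend.toLinearMap :=
    Matrix.toEuclideanLin.apply_symm_apply _
  refine ⟨U, ?_, ?_⟩
  · rw [Matrix.mem_unitaryGroup_iff', Matrix.star_eq_conjTranspose]
    apply Matrix.toEuclideanLin.injective
    rw [Matrix.toLpLin_mul_same, Matrix.toEuclideanLin_conjTranspose_eq_adjoint, hU]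
    ext1 v
    refine ext_inner_left ℂ fun u => ?_
    rw [LinearMap.comp_apply, LinearMap.adjoint_inner_right]
    simp
  · apply Matrix.toEuclideanLin.injective
    rw [Matrix.toLpLin_mul_same, hU]
    ext1 v
    exact (hLB v).symm

theorem ancilla_isometry (κ : Type u) [Fintype κ] [DecidableEq κ] (n : ℕ) :
    (ancilla κ n)ᴴ * ancilla κ n = 1 := by
  ext i j
  simp [Matrix.mul_apply, ancilla, Fintype.sum_prod_type, Matrix.one_apply, ite_and, apply_ite,
    eq_comm]

/-- Every isometry is an ancilla followed by a unitary. -/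
theorem exists_unitary_mul_ancilla {κ : Type u} [Fintype κ] [DecidableEq κ] {n : ℕ}
    {Φ : Matrix (κ × Qubits n) κ ℂ} (hΦ : Φᴴ * Φ = 1) :
    ∃ U ∈ Matrix.unitaryGroup (κ × Qubits n) ℂ, Φ = U * ancilla κ n :=
  exists_unitary_mul_eq (hΦ.trans (ancilla_isometry κ n).symm)

theorem kronecker_one_mul_ancilla {κ : Type u} [Fintype κ] [DecidableEq κ] (n : ℕ)
    (G : Matrix κ κ ℂ) :
    (G ⊗ₖ (1 : Matrix (Qubits n) (Qubits n) ℂ)) * ancilla κ n = ancilla κ n * G := by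
  ext ⟨i, x⟩ j
  simp [Matrix.mul_apply, ancilla, Fintype.sum_prod_type, Matrix.one_apply, ite_and]

end Polar

/-! ### The swap isometry -/

section Swap

variable {n : ℕ} {ι : Fin n → Type u} [∀ w, Fintype (ι w)] [∀ w, DecidableEq (ι w)]

/-- The operator `X ^ i * P i` of a single wire, where `P i` is the projection of the setting `Z`
for the output bit `i`. -/
noncomputable def swapBlock {κ : Type u} [Fintype κ] [DecidableEq κ] (M : MeasDevice κ)
    (i : Fin 2) : Matrix κ κ ℂ :=
  M.obs Setting.X ^ (i : ℕ) * M.proj Setting.Z i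

/-- The isometry `v ↦ ∑ x, X ^ x P x v ⊗ |x⟩`, which moves the qubits on which the observables
`X` and `Z` of the devices act into the ancilla. -/
noncomputable def swapIsometry (M : ∀ w, MeasDevice (ι w)) :
    Matrix (Reg ι × Qubits n) (Reg ι) ℂ :=
  Matrix.of fun p k => tensorOp (fun w => swapBlock (M w) (p.2 w)) p.1 k

theorem swapBlock_zero {κ : Type u} [Fintype κ] [DecidableEq κ] (M : MeasDevice κ) :
    swapBlock M 0 = (1 / 2 : ℂ) • (1 + M.obs .Z) := by
  simp [swapBlock, MeasDevice.proj]

theorem swapBlock_one {κ : Type u} [Fintype κ] [DecidableEq κ] (M : MeasDevice κ) :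
    swapBlock M 1 = (1 / 2 : ℂ) • (M.obs .X - M.obs .X * M.obs .Z) := by
  simp [swapBlock, MeasDevice.proj, mul_add, sub_eq_add_neg]

theorem sum_swapBlock_conjTranspose_mul_self {κ : Type u} [Fintype κ] [DecidableEq κ]
    (M : MeasDevice κ) : ∑ i, (swapBlock M i)ᴴ * swapBlock M i = 1 := by
  have hX := M.sq_eq_one .X
  have hZ := M.sq_eq_one .Z
  rw [Fin.sum_univ_two, swapBlock_zero, swapBlock_one]
  simp only [Matrix.conjTranspose_smul, Matrix.conjTranspose_add, Matrix.conjTranspose_sub,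
    Matrix.conjTranspose_mul, Matrix.conjTranspose_one, (M.isHermitian _).eq, smul_mul_smul_comm,
    add_mul, mul_add, sub_mul, mul_sub, one_mul, mul_one, hX, hZ, mul_assoc]
  rw [← mul_assoc (M.obs .X) (M.obs .X), hX, one_mul, hZ]
  rw [show star (1 / 2 : ℂ) * (1 / 2) = 1 / 4 by simp; norm_num, ← smul_add]
  rw [show (1 + M.obs .Z + (M.obs .Z + 1) + (1 - M.obs .Z - (M.obs .Z - 1)) : Matrix κ κ ℂ) =
    (4 : ℂ) • 1 by module, smul_smul]
  norm_num

theorem swapIsometry_isometry (M : ∀ w, MeasDevice (ι w)) :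
    (swapIsometry M)ᴴ * swapIsometry M = 1 := by
  have h : (swapIsometry M)ᴴ * swapIsometry M =
      ∑ x : Qubits n, (tensorOp fun w => swapBlock (M w) (x w))ᴴ *
        tensorOp fun w => swapBlock (M w) (x w) := by
    ext i j
    simp only [Matrix.mul_apply, Matrix.sum_apply, Matrix.conjTranspose_apply, swapIsometry,
      Matrix.of_apply, Fintype.sum_prod_type]
    rw [Finset.sum_comm]
  simp only [h, tensorOp_conjTranspose, tensorOp_mul]
  rw [sum_tensorOp fun w i => (swapBlock (M w) i)ᴴ * swapBlock (M w) i]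
  simp only [sum_swapBlock_conjTranspose_mul_self, tensorOp_one]

theorem one_kronecker_mul_apply {α β δ : Type*} [Fintype α] [DecidableEq α] [Fintype β]
    (R : Matrix β β ℂ) (K : Matrix (α × β) δ ℂ) (i : α) (x : β) (k : δ) :
    (((1 : Matrix α α ℂ) ⊗ₖ R) * K) (i, x) k = ∑ y, R x y * K (i, y) k := by
  simp only [Matrix.mul_apply, Matrix.kroneckerMap_apply, Fintype.sum_prod_type,
    Matrix.one_apply, ite_mul, one_mul, zero_mul]
  rw [Finset.sum_comm]
  simp

theorem swapIsometry_mul_apply {κ : Type*} (M : ∀ w, MeasDevice (ι w))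
    (A : Matrix (Reg ι) κ ℂ) (i : Reg ι) (x : Qubits n) (k : κ) :
    (swapIsometry M * A) (i, x) k = (tensorOp (fun w => swapBlock (M w) (x w)) * A) i k := rfl

theorem tensorOp_update_mul_eq_zero {κ : Type*} {w : Fin n} {m : Matrix (ι w) (ι w) ℂ}
    {A : Matrix (Reg ι) κ ℂ} (h : wireOp w m * A = 0) (B : ∀ w, Matrix (ι w) (ι w) ℂ)
    (c : Matrix (ι w) (ι w) ℂ) : tensorOp (Function.update B w (c * m)) * A = 0 := by
  rw [← tensorOp_update_mul_wireOp, Matrix.mul_assoc, h, Matrix.mul_zero]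

/-- The relations between the observables of the wires that hold in the reference experiment,
restricted to the support of a bipartite vector (the column space of a matrix). -/
structure PauliRelations {κ : Type*} (M : ∀ w, MeasDevice (ι w)) (A : Matrix (Reg ι) κ ℂ) :
    Prop where
  anticomm : ∀ w, wireOp w ((M w).obs .X * (M w).obs .Z + (M w).obs .Z * (M w).obs .X) * A = 0
  diag : ∀ w, wireOp w ((M w).obs .D - (1 / (Real.sqrt 2 : ℂ)) •
    ((M w).obs .X + (M w).obs .Z)) * A = 0

/-- Moving a setting through the blocks of the swap isometry: what is left over is a multiple of
one of the relations between the observables. -/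
theorem exists_swapBlock_mul_obs {κ : Type u} [Fintype κ] [DecidableEq κ] (M : MeasDevice κ)
    (s : Setting) (i : Fin 2) : ∃ c c' : Matrix κ κ ℂ,
      swapBlock M i * M.obs s - ∑ j, refObs s i j • swapBlock M j =
        c * (M.obs .X * M.obs .Z + M.obs .Z * M.obs .X) +
        c' * (M.obs .D - (1 / (Real.sqrt 2 : ℂ)) • (M.obs .X + M.obs .Z)) := by
  have hX := M.sq_eq_one .X
  have hZ := M.sq_eq_one .Z
  have keyZ : swapBlock M i * M.obs .Z - ∑ j, refObs .Z i j • swapBlock M j = 0 := by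
    fin_cases i
    · simp [swapBlock_zero, refObs, add_mul, hZ, add_comm]
    · simp [swapBlock_one, refObs, sub_mul, hZ, Matrix.mul_assoc, ← smul_add]
  have keyX : ∃ c : Matrix κ κ ℂ, swapBlock M i * M.obs .X - ∑ j, refObs .X i j • swapBlock M j =
      c * (M.obs .X * M.obs .Z + M.obs .Z * M.obs .X) := by
    fin_cases i
    · refine ⟨(1 / 2 : ℂ) • 1, ?_⟩
      simp [swapBlock_zero, swapBlock_one, refObs, add_mul, smul_sub]
      abel
    · refine ⟨-(1 / 2 : ℂ) • M.obs .X, ?_⟩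
      simp [swapBlock_zero, swapBlock_one, refObs, sub_mul, mul_add, smul_sub, hX,
        ← Matrix.mul_assoc]
      abel
  obtain ⟨c, hc⟩ := keyX
  cases s with
  | I =>
    refine ⟨0, 0, ?_⟩
    simp [M.obs_I, refObs, Matrix.one_apply]
  | X => exact ⟨c, 0, by rw [hc]; simp⟩
  | Z => exact ⟨0, 0, by rw [keyZ]; simp⟩
  | D =>
    refine ⟨(1 / (Real.sqrt 2 : ℂ)) • c, swapBlock M i, ?_⟩
    have hD : ∀ i j, refObs .D i j =
        1 / (Real.sqrt 2 : ℂ) * (refObs .X i j + refObs .Z i j) := fun i j => by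
      fin_cases i <;> fin_cases j <;> simp [refObs]
    rw [smul_mul_assoc, ← hc]
    simp only [hD, mul_smul, ← Finset.smul_sum, add_smul, Finset.sum_add_distrib]
    rw [← sub_eq_zero.1 keyZ, mul_sub, mul_smul_comm, mul_add]
    simp only [smul_sub, smul_add]
    abel

/-- The reference observable of `n` qubits for the settings `a`. -/
noncomputable def refJoint (a : Fin n → Setting) : Matrix (Qubits n) (Qubits n) ℂ :=
  jointObs (fun _ => refDevice) a

theorem refJoint_I : refJoint (fun _ : Fin n => Setting.I) = 1 := jointObs_I _

theorem refJoint_update (a : Fin n → Setting) (w : Fin n) (s : Setting) (ha : a w = Setting.I) :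
    refJoint (Function.update a w s) = refJoint (single w s) * refJoint a := by
  rw [refJoint, refJoint, jointObs_single, jointObs_update _ _ _ _ ha]
  rfl

theorem refJoint_single_apply (w : Fin n) (s : Setting) (x y : Qubits n) :
    refJoint (single w s) x y = ∑ i, if y = Function.update x w i then refObs s (x w) i else 0 := by
  rw [refJoint, jointObs_single, wireOp_apply]
  rfl

/-- In the row `x`, only those columns of a single-wire observable contribute that differ from `x`
at most at that wire. -/
theorem sum_refJoint_single_mul (w : Fin n) (s : Setting) (x : Qubits n) (f : Qubits n → ℂ) :
    ∑ y, refJoint (single w s) x y * f y = ∑ i, refObs s (x w) i * f (Function.update x w i) := by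
  simp only [refJoint_single_apply, Finset.sum_mul, ite_mul, zero_mul]
  rw [Finset.sum_comm]
  simp

theorem swapIsometry_mul_wireOp {κ : Type*} {M : ∀ w, MeasDevice (ι w)}
    {A : Matrix (Reg ι) κ ℂ} (hA : PauliRelations M A) (w : Fin n) (s : Setting) :
    swapIsometry M * (wireOp w ((M w).obs s) * A) =
      ((1 : Matrix (Reg ι) (Reg ι) ℂ) ⊗ₖ refJoint (single w s)) * (swapIsometry M * A) := by
  ext ⟨i, x⟩ k
  rw [one_kronecker_mul_apply, swapIsometry_mul_apply]
  rw [sum_refJoint_single_mul w s x fun y => (swapIsometry M * A) (i, y) k]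
  simp only [swapIsometry_mul_apply, ← smul_eq_mul, ← Matrix.smul_apply, ← Matrix.sum_apply,
    ← Matrix.smul_mul,
    ← Matrix.sum_mul]
  rw [← Matrix.mul_assoc, tensorOp_mul_wireOp]
  have hup : ∀ j, tensorOp (fun v => swapBlock (M v) (Function.update x w j v)) =
      tensorOp (Function.update (fun v => swapBlock (M v) (x v)) w (swapBlock (M w) j)) := by
    intro j
    congr 1
    ext1 v
    rcases eq_or_ne v w with rfl | h
    · simp
    · simp [h]
  obtain ⟨c, c', hcc⟩ := exists_swapBlock_mul_obs (M w) s (x w)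
  rw [sub_eq_iff_eq_add] at hcc
  simp only [hup, hcc, tensorOp_update_add, Matrix.add_mul, Fin.sum_univ_two, tensorOp_update_smul,
    tensorOp_update_mul_eq_zero (hA.anticomm w), tensorOp_update_mul_eq_zero (hA.diag w), zero_add]

end Swap

/-! ### Rigidity of the EPR correlations -/

section Rigidity

variable {n : ℕ} {ιA : Fin n → Type u} {ιB : Fin n → Type v}
  [∀ w, Fintype (ιA w)] [∀ w, DecidableEq (ιA w)]
  [∀ w, Fintype (ιB w)] [∀ w, DecidableEq (ιB w)]

/-- The correlation of the settings `s` and `t` measured on the two qubits of an EPR pair. -/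
noncomputable def eprCorr (s t : Setting) : ℝ := (refObs s * (refObs t)ᵀ).trace.re / 2

theorem refObs_transpose (s : Setting) : (refObs s)ᵀ = refObs s := by
  cases s <;> ext i j <;> fin_cases i <;> fin_cases j <;> simp [refObs]

theorem refObs_mul_self (s : Setting) : refObs s * refObs s = 1 := refDevice.sq_eq_one s

theorem eprCorr_self (s : Setting) : eprCorr s s = 1 := by
  rw [eprCorr, refObs_transpose, refObs_mul_self]
  simp [Matrix.trace]

theorem eprCorr_comm (s t : Setting) : eprCorr s t = eprCorr t s := by
  rw [eprCorr, eprCorr, refObs_transpose, refObs_transpose, Matrix.trace_mul_comm]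

theorem eprCorr_X_Z : eprCorr .X .Z = 0 := by
  rw [eprCorr, refObs_transpose]
  simp [refObs, Matrix.trace, Fin.sum_univ_two]

theorem eprCorr_D_X : eprCorr .D .X = 1 / Real.sqrt 2 := by
  rw [eprCorr, refObs_transpose]
  simp [refObs, Matrix.trace, Fin.sum_univ_two, Real.sqrt_div_self]

theorem eprCorr_D_Z : eprCorr .D .Z = 1 / Real.sqrt 2 := by
  rw [eprCorr, refObs_transpose]
  simp [refObs, Matrix.trace, Fin.sum_univ_two, Real.sqrt_div_self]

/-- A bipartite vector with devices on both sides has the correlations of `n` EPR pairs. -/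
def HasEPRCorr (M : ∀ w, MeasDevice (ιA w)) (N : ∀ w, MeasDevice (ιB w))
    (Ψ : Matrix (Reg ιA) (Reg ιB) ℂ) : Prop :=
  ∀ a b, frob Ψ (jointObs M a * Ψ * (jointObs N b)ᵀ) = ∏ w, eprCorr (a w) (b w)

variable {M : ∀ w, MeasDevice (ιA w)} {N : ∀ w, MeasDevice (ιB w)}
  {Ψ : Matrix (Reg ιA) (Reg ιB) ℂ}

theorem HasEPRCorr.transpose (h : HasEPRCorr M N Ψ) : HasEPRCorr N M Ψᵀ := by
  intro a b
  rw [← frob_transpose]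
  simp only [Matrix.transpose_mul, Matrix.transpose_transpose, ← Matrix.mul_assoc]
  rw [h b a]
  exact Finset.prod_congr rfl fun w _ => eprCorr_comm _ _

theorem HasEPRCorr.norm (h : HasEPRCorr M N Ψ) : frob Ψ Ψ = 1 := by
  have := h (fun _ => .I) (fun _ => .I)
  simpa [jointObs_I, eprCorr_self] using this

theorem HasEPRCorr.norm_mul (h : HasEPRCorr M N Ψ) (a : Fin n → Setting) :
    frob (jointObs M a * Ψ) (jointObs M a * Ψ) = 1 := by
  rw [frob_isometry_mul (by rw [jointObs_conjTranspose, jointObs_mul_self]), h.norm]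

theorem HasEPRCorr.norm_mul_transpose (h : HasEPRCorr M N Ψ) (a : Fin n → Setting) :
    frob (Ψ * (jointObs N a)ᵀ) (Ψ * (jointObs N a)ᵀ) = 1 := by
  rw [frob_mul_transpose_isometry (by rw [jointObs_conjTranspose, jointObs_mul_self]), h.norm]

theorem HasEPRCorr.frob_mul (h : HasEPRCorr M N Ψ) (a b : Fin n → Setting) :
    frob (jointObs M a * Ψ) (Ψ * (jointObs N b)ᵀ) = ∏ w, eprCorr (a w) (b w) := by
  rw [frob_mul_left, jointObs_conjTranspose, ← Matrix.mul_assoc, h]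

/-- Perfect correlation: the same settings act on the two sides in the same way. -/
theorem HasEPRCorr.mul_eq_mul_transpose (h : HasEPRCorr M N Ψ) (a : Fin n → Setting) :
    jointObs M a * Ψ = Ψ * (jointObs N a)ᵀ :=
  eq_of_frob_eq_one (h.norm_mul a) (h.norm_mul_transpose a)
    (by rw [h.frob_mul]; exact Finset.prod_eq_one fun w _ => eprCorr_self _)

theorem HasEPRCorr.frob_single (h : HasEPRCorr M N Ψ) (w : Fin n) (s t : Setting) :
    frob (jointObs M (single w s) * Ψ) (jointObs M (single w t) * Ψ) = eprCorr s t := by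
  rw [h.mul_eq_mul_transpose (single w t), h.frob_mul, Finset.prod_eq_single w]
  · simp [single]
  · intro v _ hv
    simp [single, hv, eprCorr_self]
  · simp

theorem sqrt_two_inv_mul_self : (1 / Real.sqrt 2) * (1 / Real.sqrt 2) = 1 / 2 := by
  rw [div_mul_div_comm, Real.mul_self_sqrt (by norm_num), one_mul]

/-- The unit vectors `X ψ` and `Z ψ` are orthogonal and `D ψ` has inner product `1 / √2` with both
of them, hence `D ψ = (X ψ + Z ψ) / √2`. -/
theorem HasEPRCorr.single_D (h : HasEPRCorr M N Ψ) (w : Fin n) :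
    jointObs M (single w .D) * Ψ = ((1 / Real.sqrt 2 : ℝ) : ℂ) •
      (jointObs M (single w .X) * Ψ + jointObs M (single w .Z) * Ψ) := by
  refine eq_of_frob_eq_one (h.norm_mul _) ?_ ?_
  · simp only [frob_smul_left, frob_smul_right, frob_add_left, frob_add_right, h.frob_single,
      eprCorr_self, eprCorr_X_Z, eprCorr_comm .Z .X]
    rw [add_zero, zero_add, mul_one, mul_add, sqrt_two_inv_mul_self]
    norm_num
  · simp only [frob_smul_right, frob_add_right, h.frob_single, eprCorr_D_X, eprCorr_D_Z]
    rw [mul_add, sqrt_two_inv_mul_self]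
    norm_num

/-- Since `D² = 1`, the relation `D ψ = (X ψ + Z ψ) / √2` forces `X` and `Z` to anticommute
on `ψ`: the second `D` acts on a vector in which `X` and `Z` have been moved to the other side. -/
theorem HasEPRCorr.pauliRelations (h : HasEPRCorr M N Ψ) : PauliRelations M Ψ := by
  have hcast : ((1 / Real.sqrt 2 : ℝ) : ℂ) = 1 / (Real.sqrt 2 : ℂ) := by push_cast; rfl
  constructor
  · intro w
    have hD := h.single_D w
    have hX := h.mul_eq_mul_transpose (single w .X)
    have hZ := h.mul_eq_mul_transpose (single w .Z)
    have hsum : ∀ c : ℂ, c • (jointObs M (single w .X) * Ψ + jointObs M (single w .Z) * Ψ) =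
        Ψ * (c • ((jointObs N (single w .X))ᵀ + (jointObs N (single w .Z))ᵀ)) := by
      intro c
      rw [hX, hZ, Matrix.mul_smul, Matrix.mul_add]
    have h1 : jointObs M (single w .D) * (jointObs M (single w .D) * Ψ) = Ψ := by
      rw [← Matrix.mul_assoc, jointObs_mul_self, Matrix.one_mul]
    have h2 : ∀ s, jointObs M (single w s) * (jointObs M (single w s) * Ψ) = Ψ := fun s => by
      rw [← Matrix.mul_assoc, jointObs_mul_self, Matrix.one_mul]
    -- `ψ = D (D ψ) = (X + Z)² ψ / 2`, and `(X + Z)² = 2 + X Z + Z X`.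
    rw [hD, hsum, ← Matrix.mul_assoc, hD, Matrix.smul_mul, Matrix.add_mul, Matrix.mul_assoc,
      Matrix.mul_assoc, ← hsum, hcast, Matrix.mul_smul, Matrix.mul_smul, ← smul_add, smul_smul,
      inv_sqrt_two_mul_self, Matrix.mul_add, Matrix.mul_add, h2, h2] at h1
    rw [wireOp_add, wireOp_mul, wireOp_mul, ← jointObs_single, ← jointObs_single, Matrix.add_mul,
      Matrix.mul_assoc, Matrix.mul_assoc]
    have h3 := congrArg (fun A => (2 : ℂ) • A) h1
    simp only [smul_smul] at h3
    norm_num at h3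
    rw [two_smul, ← sub_eq_zero] at h3
    rw [← h3]
    abel
  · intro w
    rw [wireOp_sub, wireOp_smul, wireOp_add, ← jointObs_single, ← jointObs_single,
      ← jointObs_single, Matrix.sub_mul, h.single_D, hcast, Matrix.smul_mul, Matrix.add_mul,
      sub_self]

/-- The swap isometry turns the observables of the devices into the reference observables. -/
theorem HasEPRCorr.swapIsometry_mul (h : HasEPRCorr M N Ψ) (a : Fin n → Setting) :
    swapIsometry M * (jointObs M a * Ψ) =
      ((1 : Matrix (Reg ιA) (Reg ιA) ℂ) ⊗ₖ refJoint a) *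
        (swapIsometry M * Ψ) := by
  suffices H : ∀ s : Finset (Fin n),
      swapIsometry M * (jointObs M (s.piecewise a fun _ => .I) * Ψ) =
        ((1 : Matrix (Reg ιA) (Reg ιA) ℂ) ⊗ₖ
          refJoint (s.piecewise a fun _ => .I)) * (swapIsometry M * Ψ) by
    simpa using H Finset.univ
  intro s
  induction s using Finset.induction_on with
  | empty => simp [jointObs_I, refJoint_I]
  | insert w s hw ih =>
    have hI : s.piecewise a (fun _ => Setting.I) w = .I := by simp [hw]
    -- The observables of the wires in `s` are moved to side `B`, so that the observable of the
    -- wire `w` meets the isometry and `ψ` only, and are moved back afterwards.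
    rw [Finset.piecewise_insert, jointObs_update _ _ _ _ hI, refJoint_update _ _ _ hI,
      Matrix.mul_assoc (wireOp _ _), h.mul_eq_mul_transpose, ← Matrix.mul_assoc (wireOp _ _),
      ← Matrix.mul_assoc, swapIsometry_mul_wireOp h.pauliRelations, Matrix.mul_assoc,
      Matrix.mul_assoc, ← h.mul_eq_mul_transpose, ih, ← Matrix.mul_assoc,
      ← Matrix.mul_kronecker_mul, Matrix.one_mul]

end Rigidity

/-! ### The commutant of the qubit observables -/

section Commutant

variable {n : ℕ} {α β γ : Type*}

theorem refJoint_conjTranspose (a : Fin n → Setting) : (refJoint a)ᴴ = refJoint a :=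
  jointObs_conjTranspose _ a

theorem refJoint_mul_self (a : Fin n → Setting) : refJoint a * refJoint a = 1 :=
  jointObs_mul_self _ a

theorem refJoint_transpose (a : Fin n → Setting) : (refJoint a)ᵀ = refJoint a := by
  rw [refJoint, jointObs, tensorOp_transpose]
  congr 1
  ext1 w
  exact refObs_transpose _

theorem one_kronecker_refJoint_transpose [DecidableEq α] (a : Fin n → Setting) :
    ((1 : Matrix α α ℂ) ⊗ₖ refJoint a)ᵀ = (1 : Matrix α α ℂ) ⊗ₖ refJoint a := by
  rw [← Matrix.kroneckerMap_transpose, Matrix.transpose_one, refJoint_transpose]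

/-- The observables `X` and `Z` of the single qubits generate the full matrix algebra, so an
operator that commutes with them acts trivially on the qubits.  The observables `Z` make the
operator diagonal in the qubits and the observables `X` make all diagonal blocks equal. -/
theorem exists_eq_kronecker_one [Fintype α] [DecidableEq α] [Fintype β] [DecidableEq β]
    {K : Matrix (α × Qubits n) (β × Qubits n) ℂ}
    (h : ∀ (w : Fin n) (s : Setting), s = Setting.X ∨ s = Setting.Z →
      ((1 : Matrix α α ℂ) ⊗ₖ refJoint (single w s)) * K =
        K * ((1 : Matrix β β ℂ) ⊗ₖ refJoint (single w s))) :
    ∃ J : Matrix α β ℂ, K = J ⊗ₖ (1 : Matrix (Qubits n) (Qubits n) ℂ) := by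
  have key : ∀ (w : Fin n) (s : Setting), s = Setting.X ∨ s = Setting.Z →
      ∀ (i : α) (j : β) (x y : Qubits n),
      ∑ b, refObs s (x w) b * K (i, Function.update x w b) (j, y) =
        ∑ b, refObs s (y w) b * K (i, x) (j, Function.update y w b) := by
    intro w s hs i j x y
    rw [← sum_refJoint_single_mul w s x fun z => K (i, z) (j, y),
      ← sum_refJoint_single_mul w s y fun z => K (i, x) (j, z),
      ← one_kronecker_mul_apply, h w s hs, ← Matrix.transpose_apply (K * _),
      Matrix.transpose_mul, one_kronecker_refJoint_transpose, one_kronecker_mul_apply]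
    rfl
  have hoff : ∀ i j x y, x ≠ y → K (i, x) (j, y) = 0 := by
    intro i j x y hxy
    obtain ⟨w, hw⟩ := Function.ne_iff.1 hxy
    have hZ : ∀ (p : Fin 2) (f : Fin 2 → ℂ), ∑ b, refObs .Z p b * f b = (-1) ^ (p : ℕ) * f p := by
      intro p f
      fin_cases p <;> simp [refObs]
    have := key w .Z (Or.inr rfl) i j x y
    rw [hZ, hZ, Function.update_eq_self, Function.update_eq_self] at this
    generalize x w = p at this hw
    generalize y w = q at this hw
    fin_cases p <;> fin_cases q <;> simp at this hw
    · linear_combination this / 2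
    · linear_combination -this / 2
  have hdiag : ∀ i j x w b,
      K (i, Function.update x w b) (j, Function.update x w b) = K (i, x) (j, x) := by
    intro i j x w b
    have hX : ∀ (p : Fin 2) (f : Fin 2 → ℂ), ∑ b, refObs .X p b * f b = f (1 - p) := by
      intro p f
      fin_cases p <;> simp [refObs]
    rcases eq_or_ne b (x w) with rfl | hb
    · rw [Function.update_eq_self]
    · have := key w .X (Or.inl rfl) i j x (Function.update x w b)
      rw [hX, hX, Function.update_self, Function.update_idem] at this
      have h1 : 1 - x w = b := by omega
      have h2 : 1 - b = x w := by omega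
      rwa [h1, h2, Function.update_eq_self] at this
  refine ⟨Matrix.of fun i j => K (i, 0) (j, 0), ?_⟩
  ext ⟨i, x⟩ ⟨j, y⟩
  rw [Matrix.kroneckerMap_apply, Matrix.of_apply, Matrix.one_apply]
  split_ifs with hxy
  · subst hxy
    rw [mul_one]
    suffices H : ∀ s : Finset (Fin n),
        K (i, s.piecewise x 0) (j, s.piecewise x 0) = K (i, 0) (j, 0) by
      simpa using H Finset.univ
    intro s
    induction s using Finset.induction_on with
    | empty => simp
    | insert w s _ ih => rw [Finset.piecewise_insert, hdiag, ih]
  · rw [mul_zero, hoff i j x y hxy]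

theorem kronecker_one_injective (n : ℕ) {J J' : Matrix α β ℂ}
    (h : J ⊗ₖ (1 : Matrix (Qubits n) (Qubits n) ℂ) = J' ⊗ₖ (1 : Matrix (Qubits n) (Qubits n) ℂ)) :
    J = J' := by
  ext i j
  simpa using congrFun (congrFun h (i, 0)) (j, 0)

/-- If two isometries map the same vectors to `J ⊗ S` and `J' ⊗ S'` with `S`, `S'` unitary, then
`J` and `J'` have the same Gram matrix and differ by a unitary. -/
theorem exists_unitary_mul_eq_of_kronecker {κ : Type*} [Fintype α] [DecidableEq α] [Fintype β]
    [DecidableEq β] [Fintype κ] [DecidableEq κ] {U U' : Matrix (α × Qubits n) κ ℂ}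
    (hU : Uᴴ * U = 1) (hU' : U'ᴴ * U' = 1) {P : Matrix κ (β × Qubits n) ℂ}
    {J J' : Matrix α β ℂ} {S S' : Matrix (Qubits n) (Qubits n) ℂ}
    (hS : Sᴴ * S = 1) (hS' : S'ᴴ * S' = 1) (h : U * P = J ⊗ₖ S) (h' : U' * P = J' ⊗ₖ S') :
    ∃ W ∈ Matrix.unitaryGroup α ℂ, J = W * J' := by
  have gram : ∀ {V : Matrix (α × Qubits n) κ ℂ} {I : Matrix α β ℂ}
      {R : Matrix (Qubits n) (Qubits n) ℂ}, Vᴴ * V = 1 → Rᴴ * R = 1 → V * P = I ⊗ₖ R →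
      (Iᴴ * I) ⊗ₖ (1 : Matrix (Qubits n) (Qubits n) ℂ) = Pᴴ * P := by
    intro V I R hV hR e
    rw [← hR, Matrix.mul_kronecker_mul, ← Matrix.conjTranspose_kronecker, ← e,
      Matrix.conjTranspose_mul, Matrix.mul_assoc, ← Matrix.mul_assoc Vᴴ, hV, Matrix.one_mul]
  exact exists_unitary_mul_eq
    (kronecker_one_injective n ((gram hU hS h).trans (gram hU' hS' h').symm))

end Commutant

/-! ### The junk vector -/

section Junk

variable {n : ℕ} {ιA : Fin n → Type u} {ιB : Fin n → Type v}
  [∀ w, Fintype (ιA w)] [∀ w, DecidableEq (ιA w)]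
  [∀ w, Fintype (ιB w)] [∀ w, DecidableEq (ιB w)]
  {M M₂ : ∀ w, MeasDevice (ιA w)} {N : ∀ w, MeasDevice (ιB w)}
  {Ψ : Matrix (Reg ιA) (Reg ιB) ℂ}

theorem HasEPRCorr.mul_swapIsometry_transpose (h : HasEPRCorr M N Ψ) (a : Fin n → Setting) :
    Ψ * (jointObs N a)ᵀ * (swapIsometry N)ᵀ = Ψ * (swapIsometry N)ᵀ *
      ((1 : Matrix (Reg ιB) (Reg ιB) ℂ) ⊗ₖ refJoint a) := by
  have := congrArg Matrix.transpose (h.transpose.swapIsometry_mul a)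
  rwa [Matrix.transpose_mul, Matrix.transpose_mul, Matrix.transpose_mul, Matrix.transpose_mul,
    Matrix.transpose_transpose, one_kronecker_refJoint_transpose] at this

/-- A vector with the correlations of `n` EPR pairs is, up to the two swap isometries, the tensor
product of a junk vector and `n` EPR pairs (which as a matrix are a multiple of `1`). -/
theorem HasEPRCorr.exists_junk (h : HasEPRCorr M N Ψ) : ∃ J : Matrix (Reg ιA) (Reg ιB) ℂ,
    swapIsometry M * Ψ * (swapIsometry N)ᵀ = J ⊗ₖ (1 : Matrix (Qubits n) (Qubits n) ℂ) := by
  refine exists_eq_kronecker_one fun w s _ => ?_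
  rw [← Matrix.mul_assoc, ← h.swapIsometry_mul, h.mul_eq_mul_transpose, Matrix.mul_assoc,
    h.mul_swapIsometry_transpose]
  simp only [Matrix.mul_assoc]

/-! ### The gate -/

/-- A real unitary whose conjugation maps the observables `X` and `Z` of each single qubit to real
combinations of the reference observables. -/
structure IsAdmissibleGate (T : Matrix (Qubits n) (Qubits n) ℂ) : Prop where
  conjTranspose_mul : Tᴴ * T = 1
  mul_conjTranspose : T * Tᴴ = 1
  transpose_eq : Tᵀ = Tᴴ
  conj_mem : ∀ w s, s = Setting.X ∨ s = Setting.Z →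
    ∃ (k : ℕ) (b : Fin k → Fin n → Setting) (c : Fin k → ℝ),
      Tᴴ * refJoint (single w s) * T = ∑ i, (c i : ℂ) • refJoint (b i)

/-- The amplitude `2 ^ (-n / 2)` of `n` EPR pairs. -/
noncomputable def eprAmp (n : ℕ) : ℝ := (1 / Real.sqrt 2) ^ n

theorem eprAmp_mul_self (n : ℕ) : eprAmp n * eprAmp n * (2 : ℝ) ^ n = 1 := by
  rw [eprAmp, ← mul_pow, ← mul_pow, sqrt_two_inv_mul_self]
  norm_num

theorem card_qubits_cast (n : ℕ) :
    ((Fintype.card (Qubits n) : ℕ) : ℂ) = (((2 : ℝ) ^ n : ℝ) : ℂ) := by simp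

/-- The correlations after applying the gate on side `A` show that an observable of the second
device, applied after the gate, acts as the conjugated observable on side `B`. Moving the latter
through the isometries, `(Φ₂ ⊗ Φ) (G ⊗ 1) ψ` has the form `junk ⊗ (T ⊗ 1) φ`. -/
theorem HasEPRCorr.exists_junk_gate (h : HasEPRCorr M N Ψ)
    {T : Matrix (Qubits n) (Qubits n) ℂ} (hT : IsAdmissibleGate T)
    {G : Matrix (Reg ιA) (Reg ιA) ℂ} (hG : Gᴴ * G = 1)
    (hM₂ : ∀ a, swapIsometry M₂ * (jointObs M₂ a * (G * Ψ)) =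
      ((1 : Matrix (Reg ιA) (Reg ιA) ℂ) ⊗ₖ refJoint a) * (swapIsometry M₂ * (G * Ψ)))
    (hcorr : ∀ a b, frob (G * Ψ) (jointObs M₂ a * (G * Ψ) * (jointObs N b)ᵀ) =
      frob ((eprAmp n : ℂ) • T) (refJoint a * ((eprAmp n : ℂ) • T) * (refJoint b)ᵀ)) :
    ∃ J : Matrix (Reg ιA) (Reg ιB) ℂ,
      swapIsometry M₂ * (G * Ψ) * (swapIsometry N)ᵀ = J ⊗ₖ T := by
  suffices H : ∃ J : Matrix (Reg ιA) (Reg ιB) ℂ, swapIsometry M₂ * (G * Ψ) * (swapIsometry N)ᵀ *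
      ((1 : Matrix (Reg ιB) (Reg ιB) ℂ) ⊗ₖ Tᴴ) = J ⊗ₖ (1 : Matrix (Qubits n) (Qubits n) ℂ) by
    obtain ⟨J, hJ⟩ := H
    refine ⟨J, ?_⟩
    have := congrArg (· * ((1 : Matrix (Reg ιB) (Reg ιB) ℂ) ⊗ₖ T)) hJ
    simpa only [Matrix.mul_assoc, ← Matrix.mul_kronecker_mul, Matrix.one_mul, Matrix.mul_one,
      hT.conjTranspose_mul, Matrix.one_kronecker_one] using this
  refine exists_eq_kronecker_one fun w s hs => ?_
  obtain ⟨k, b, c, hQ⟩ := hT.conj_mem w s hs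
  set Q := Tᴴ * refJoint (single w s) * T with hQdef
  have hQH : Qᴴ = Q := by
    simp only [hQdef, Matrix.conjTranspose_mul, Matrix.conjTranspose_conjTranspose,
      refJoint_conjTranspose, Matrix.mul_assoc]
  have hQQ : Q * Q = 1 := by
    calc Q * Q = Tᴴ * refJoint (single w s) * (T * Tᴴ) * refJoint (single w s) * T := by
          simp only [hQdef, Matrix.mul_assoc]
      _ = 1 := by
          rw [hT.mul_conjTranspose, Matrix.mul_one, Matrix.mul_assoc Tᴴ, refJoint_mul_self,
            Matrix.mul_one, hT.conjTranspose_mul]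
  have hQT : Qᵀ = Q := by
    rw [hQ, Matrix.transpose_sum]
    simp only [Matrix.transpose_smul, refJoint_transpose]
  let q : Matrix (Reg ιB) (Reg ιB) ℂ := ∑ i, (c i : ℂ) • (jointObs N (b i))ᵀ
  -- `q` is the combination of observables of side `B` that plays the role of `Q`; through the
  -- isometry of side `B` it acts on `ψ` as `Q`, and in particular preserves the norm.
  have hq : Ψ * q * (swapIsometry N)ᵀ = Ψ * (swapIsometry N)ᵀ *
      ((1 : Matrix (Reg ιB) (Reg ιB) ℂ) ⊗ₖ Q) := by
    have hk : (1 : Matrix (Reg ιB) (Reg ιB) ℂ) ⊗ₖ Q =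
        ∑ i, (c i : ℂ) • ((1 : Matrix (Reg ιB) (Reg ιB) ℂ) ⊗ₖ refJoint (b i)) := by
      rw [hQ]
      ext ⟨i, x⟩ ⟨j, y⟩
      simp only [Matrix.kroneckerMap_apply, Matrix.sum_apply, Matrix.smul_apply, smul_eq_mul,
        Finset.mul_sum]
      exact Finset.sum_congr rfl fun _ _ => by ring
    simp only [hk, q, Matrix.mul_sum, Matrix.sum_mul, Matrix.mul_smul, Matrix.smul_mul,
      h.mul_swapIsometry_transpose]
  have hnorm : frob (G * Ψ) (G * Ψ) = 1 := by rw [frob_isometry_mul hG, h.norm]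
  have hact : jointObs M₂ (single w s) * (G * Ψ) = G * Ψ * q := by
    refine eq_of_frob_eq_one ?_ ?_ ?_
    · rw [frob_isometry_mul (by rw [jointObs_conjTranspose, jointObs_mul_self]), hnorm]
    · have hU : ((1 : Matrix (Reg ιB) (Reg ιB) ℂ) ⊗ₖ Q)ᴴ *
          ((1 : Matrix (Reg ιB) (Reg ιB) ℂ) ⊗ₖ Q) = 1 := by
        rw [Matrix.conjTranspose_kronecker, ← Matrix.mul_kronecker_mul, hQH, hQQ,
          Matrix.conjTranspose_one, Matrix.one_mul, Matrix.one_kronecker_one]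
      have hUT : ((1 : Matrix (Reg ιB) (Reg ιB) ℂ) ⊗ₖ Q)ᵀ = (1 : Matrix _ _ ℂ) ⊗ₖ Q := by
        rw [← Matrix.kroneckerMap_transpose, Matrix.transpose_one, hQT]
      rw [Matrix.mul_assoc, frob_isometry_mul hG,
        ← frob_mul_transpose_isometry (swapIsometry_isometry N), hq, ← hUT,
        frob_mul_transpose_isometry hU, frob_mul_transpose_isometry (swapIsometry_isometry N),
        h.norm]
    · have hQ' : ∑ i, (c i : ℂ) • (refJoint (b i))ᵀ = Q := by
        simp only [refJoint_transpose, hQ]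
      rw [frob_mul_left, jointObs_conjTranspose, ← Matrix.mul_assoc]
      simp only [q, Matrix.mul_sum, Matrix.mul_smul, frob_sum_right, frob_smul_right, hcorr]
      simp only [← frob_smul_right, ← frob_sum_right, ← Matrix.mul_smul, ← Matrix.mul_sum]
      rw [hQ', Matrix.mul_smul, Matrix.smul_mul, frob_smul_left, frob_smul_right, frob,
        Matrix.mul_assoc (refJoint _), ← Matrix.mul_assoc Tᴴ,
        ← Matrix.mul_assoc, ← hQdef, hQQ, ← mul_assoc, Matrix.trace_one,
        card_qubits_cast, Complex.ofReal_re, eprAmp_mul_self]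
  rw [← Matrix.mul_assoc, ← Matrix.mul_assoc, ← hM₂, hact]
  calc swapIsometry M₂ * (G * Ψ * q) * (swapIsometry N)ᵀ * ((1 : Matrix (Reg ιB) (Reg ιB) ℂ) ⊗ₖ Tᴴ)
      = swapIsometry M₂ * (G * (Ψ * q * (swapIsometry N)ᵀ)) *
          ((1 : Matrix (Reg ιB) (Reg ιB) ℂ) ⊗ₖ Tᴴ) := by simp only [Matrix.mul_assoc]
    _ = swapIsometry M₂ * (G * Ψ) * (swapIsometry N)ᵀ *
          ((1 : Matrix (Reg ιB) (Reg ιB) ℂ) ⊗ₖ (Q * Tᴴ)) := by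
        rw [hq]
        simp only [Matrix.mul_assoc, ← Matrix.mul_kronecker_mul, Matrix.one_mul]
    _ = _ := by
        rw [hQdef, Matrix.mul_assoc _ T, hT.mul_conjTranspose, Matrix.mul_one]
        simp only [Matrix.mul_assoc, ← Matrix.mul_kronecker_mul, Matrix.one_mul]

end Junk

/-! ### The reference gates -/

section ReferenceGates

theorem refJoint_apply {n : ℕ} (a : Fin n → Setting) (x y : Qubits n) :
    refJoint a x y = ∏ w, refObs (a w) (x w) (y w) := rfl

/-- The real symmetric `2 × 2` matrices are spanned by `I`, `X` and `Z`. -/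
theorem exists_eq_sum_refJoint_of_real_symmetric {Q : Matrix (Qubits 1) (Qubits 1) ℂ}
    (hsymm : Qᵀ = Q) (hreal : ∀ x y, (Q x y).im = 0) :
    ∃ (k : ℕ) (b : Fin k → Fin 1 → Setting) (c : Fin k → ℝ),
      Q = ∑ i, (c i : ℂ) • refJoint (b i) := by
  have hre : ∀ x y, ((Q x y).re : ℂ) = Q x y := fun x y =>
    Complex.ext (by simp) (by simp [hreal])
  let e : Fin 2 → Qubits 1 := fun i _ => i
  have he : ∀ x : Qubits 1, x = e (x 0) := fun x => funext fun w => by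
    rw [Subsingleton.elim w 0]
  refine ⟨3, ![fun _ => .I, fun _ => .X, fun _ => .Z],
    ![((Q (e 0) (e 0)).re + (Q (e 1) (e 1)).re) / 2, (Q (e 0) (e 1)).re,
      ((Q (e 0) (e 0)).re - (Q (e 1) (e 1)).re) / 2], ?_⟩
  have h10 : Q (e 1) (e 0) = Q (e 0) (e 1) := congrFun (congrFun hsymm (e 0)) (e 1)
  ext x y
  rw [he x, he y]
  generalize x 0 = i
  generalize y 0 = j
  simp only [Fin.sum_univ_three, Matrix.add_apply, Matrix.smul_apply, refJoint_apply]
  fin_cases i <;> fin_cases j <;> simp [refObs, hre, h10, e] <;> ring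

theorem IsReferenceGate.isAdmissibleGate {n : ℕ} {T : Matrix (Qubits n) (Qubits n) ℂ}
    (hT : IsReferenceGate n T) : IsAdmissibleGate T := by
  cases hT with
  | realQubit T hU hR =>
    have hTT : Tᵀ = Tᴴ := by
      ext x y
      rw [Matrix.transpose_apply, Matrix.conjTranspose_apply, Complex.star_def, eq_comm,
        Complex.conj_eq_iff_im, hR]
    refine ⟨Matrix.mem_unitaryGroup_iff'.1 hU, Matrix.mem_unitaryGroup_iff.1 hU, hTT, ?_⟩
    intro w s _
    have hRT : (Tᴴ * refJoint (single w s) * T)ᵀ = Tᴴ * refJoint (single w s) * T := by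
      rw [← hTT]
      simp only [Matrix.transpose_mul, refJoint_transpose, Matrix.transpose_transpose,
        Matrix.mul_assoc]
    refine exists_eq_sum_refJoint_of_real_symmetric hRT fun x y => ?_
    -- A matrix that is both symmetric and Hermitian has real entries.
    have hRH : (Tᴴ * refJoint (single w s) * T)ᴴ = Tᴴ * refJoint (single w s) * T := by
      simp only [Matrix.conjTranspose_mul, refJoint_conjTranspose,
        Matrix.conjTranspose_conjTranspose, Matrix.mul_assoc]
    rw [← Complex.conj_eq_iff_im]
    exact congrFun (congrFun (hRH.trans hRT.symm) y) x
  | ctrlZ =>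
    have hH : GateSelfTest.ctrlZᴴ = GateSelfTest.ctrlZ := by
      rw [GateSelfTest.ctrlZ, Matrix.diagonal_conjTranspose]
      congr 1
      ext x
      rw [Pi.star_apply]
      split_ifs <;> simp
    have hsq : GateSelfTest.ctrlZ * GateSelfTest.ctrlZ = 1 := by
      rw [GateSelfTest.ctrlZ, Matrix.diagonal_mul_diagonal, ← Matrix.diagonal_one]
      congr 1
      ext x
      split_ifs <;> simp
    have hconj : ∀ a b : Fin 2 → Setting, (∀ i j k l : Fin 2,
        (if i = 1 ∧ j = 1 then (-1 : ℂ) else 1) * (refObs (a 0) i k * refObs (a 1) j l) *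
          (if k = 1 ∧ l = 1 then -1 else 1) = refObs (b 0) i k * refObs (b 1) j l) →
        ∃ (k : ℕ) (b : Fin k → Fin 2 → Setting) (c : Fin k → ℝ),
          GateSelfTest.ctrlZᴴ * refJoint a * GateSelfTest.ctrlZ =
            ∑ i, (c i : ℂ) • refJoint (b i) := by
      intro a b h
      refine ⟨1, fun _ => b, fun _ => 1, ?_⟩
      rw [hH]
      ext x y
      rw [GateSelfTest.ctrlZ, Matrix.mul_diagonal, Matrix.diagonal_mul]
      simp only [Finset.univ_unique, Finset.sum_singleton, Complex.ofReal_one, one_smul,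
        refJoint_apply, Fin.prod_univ_two]
      exact h _ _ _ _
    refine ⟨by rw [hH, hsq], by rw [hH, hsq], ?_, ?_⟩
    · rw [hH, GateSelfTest.ctrlZ, Matrix.diagonal_transpose]
    · intro w s hs
      -- Conjugation by `CTRL-Z` fixes `Z` on either qubit and maps `X ⊗ 1` to `X ⊗ Z` and
      -- `1 ⊗ X` to `Z ⊗ X`.
      rcases hs with rfl | rfl
      · refine hconj _ (Function.update (fun _ => .Z) w .X) fun i j k l => ?_
        fin_cases w <;> fin_cases i <;> fin_cases j <;> fin_cases k <;> fin_cases l <;>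
          simp [single, refObs]
      · refine hconj _ (single w .Z) fun i j k l => ?_
        fin_cases w <;> fin_cases i <;> fin_cases j <;> fin_cases k <;> fin_cases l <;>
          simp [single, refObs]

end ReferenceGates

/-! ### From statistics to correlations -/

section Statistics

variable {n : ℕ} {ι : Fin n → Type u} {ιA : Fin n → Type u} {ιB : Fin n → Type v}
  [∀ w, Fintype (ι w)] [∀ w, DecidableEq (ι w)]
  [∀ w, Fintype (ιA w)] [∀ w, DecidableEq (ιA w)]
  [∀ w, Fintype (ιB w)] [∀ w, DecidableEq (ιB w)]

theorem sum_smul_proj {κ : Type u} [Fintype κ] [DecidableEq κ] (M : MeasDevice κ) (s : Setting) :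
    ∑ i : Fin 2, ((-1 : ℂ) ^ (i : ℕ)) • M.proj s i = M.obs s := by
  simp only [MeasDevice.proj, Fin.sum_univ_two, Fin.val_zero, Fin.val_one, pow_zero, pow_one]
  module

/-- The joint observable is the sum of the projections for the outputs `x`, weighted with the
product of the values `±1` of the single wires. -/
theorem sum_smul_tensorOp_proj (M : ∀ w, MeasDevice (ι w)) (a : Fin n → Setting) :
    ∑ x : Qubits n, ((∏ w, (-1 : ℝ) ^ (x w : ℕ) : ℝ) : ℂ) •
      tensorOp (fun w => (M w).proj (a w) (x w)) = jointObs M a := by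
  push_cast
  simp only [← tensorOp_smul fun w => _]
  rw [sum_tensorOp fun w i => ((-1 : ℂ) ^ (i : ℕ)) • (M w).proj (a w) i]
  simp only [sum_smul_proj, jointObs]

theorem Experiment.prob_eq_frob (E : Experiment ιA ιB) (a b : Fin n → Setting)
    (x y : Fin n → Fin 2) : E.prob a b x y = frob (asMatrix E.state)
      (tensorOp (fun w => (E.measA w).proj (a w) (x w)) * asMatrix E.state *
        (tensorOp fun w => (E.measB w).proj (b w) (y w))ᵀ) := by
  rw [← asMatrix_kronecker_mulVec, frob_asMatrix, Experiment.prob]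

/-- The correlations of an experiment are determined by its statistics. -/
theorem Experiment.frob_jointObs (E : Experiment ιA ιB) (a b : Fin n → Setting) :
    frob (asMatrix E.state) (jointObs E.measA a * asMatrix E.state * (jointObs E.measB b)ᵀ) =
      ∑ y : Qubits n, ∑ x : Qubits n, (∏ w, (-1 : ℝ) ^ (y w : ℕ)) *
        ((∏ w, (-1 : ℝ) ^ (x w : ℕ)) * E.prob a b x y) := by
  simp only [prob_eq_frob]
  rw [← sum_smul_tensorOp_proj E.measA, ← sum_smul_tensorOp_proj E.measB]
  simp only [Matrix.transpose_sum, Matrix.transpose_smul, Matrix.mul_sum, Matrix.sum_mul,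
    Matrix.mul_smul, Matrix.smul_mul, frob_sum_right, frob_smul_right, Finset.mul_sum]

theorem Experiment.Simulates.frob_jointObs {E : Experiment ιA ιB}
    {R : Experiment (fun _ : Fin n => Fin 2) (fun _ : Fin n => Fin 2)} (h : E.Simulates R)
    (a b : Fin n → Setting) :
    frob (asMatrix E.state) (jointObs E.measA a * asMatrix E.state * (jointObs E.measB b)ᵀ) =
      frob (asMatrix R.state)
        (jointObs R.measA a * asMatrix R.state * (jointObs R.measB b)ᵀ) := by
  rw [E.frob_jointObs, R.frob_jointObs]
  simp only [h a b]

theorem asMatrix_refState (n : ℕ) :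
    asMatrix (refState n) = (eprAmp n : ℂ) • (1 : Matrix (Qubits n) (Qubits n) ℂ) := by
  ext x y
  simp [asMatrix, refState, eprPair, eprAmp, Finset.prod_ite_zero, Matrix.one_apply,
    funext_iff]

theorem asMatrix_refExperiment (S T : Matrix (Qubits n) (Qubits n) ℂ) :
    asMatrix (refExperiment S T).state = (eprAmp n : ℂ) • (S * Tᵀ) := by
  rw [refExperiment, asMatrix_kronecker_mulVec, asMatrix_refState, Matrix.mul_smul,
    Matrix.smul_mul, Matrix.mul_one]

theorem trace_refObs_mul (s t : Setting) :
    (refObs s * (refObs t)ᵀ).trace = ((2 * eprCorr s t : ℝ) : ℂ) := by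
  have h : star (refObs s * (refObs t)ᵀ).trace = (refObs s * (refObs t)ᵀ).trace := by
    rw [← Matrix.trace_conjTranspose, Matrix.conjTranspose_mul, refObs_transpose,
      show (refObs s)ᴴ = refObs s from refDevice.isHermitian s,
      show (refObs t)ᴴ = refObs t from refDevice.isHermitian t,
      Matrix.trace_mul_comm]
  rw [eprCorr, mul_div_cancel₀ _ (two_ne_zero)]
  exact (Complex.conj_eq_iff_re.1 h).symm

/-- The reference state has the correlations of `n` EPR pairs; they are the product of the
correlations of the single wires. -/
theorem frob_refJoint (a b : Fin n → Setting) :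
    frob ((eprAmp n : ℂ) • (1 : Matrix (Qubits n) (Qubits n) ℂ))
      (refJoint a * ((eprAmp n : ℂ) • (1 : Matrix (Qubits n) (Qubits n) ℂ)) * (refJoint b)ᵀ) =
      ∏ w, eprCorr (a w) (b w) := by
  have h : (refJoint a * (refJoint b)ᵀ).trace =
      (((2 : ℝ) ^ n * ∏ w, eprCorr (a w) (b w) : ℝ) : ℂ) := by
    rw [refJoint, refJoint, jointObs, jointObs, tensorOp_transpose, tensorOp_mul, trace_tensorOp]
    have : ∀ w, (refDevice.obs (a w) * (refDevice.obs (b w))ᵀ).trace =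
        ((2 * eprCorr (a w) (b w) : ℝ) : ℂ) := fun w => trace_refObs_mul _ _
    simp only [this, ← Complex.ofReal_prod, Finset.prod_mul_distrib]
    simp
  rw [Matrix.mul_smul, Matrix.smul_mul, frob_smul_left, frob_smul_right, frob, Matrix.mul_one,
    Matrix.conjTranspose_one, Matrix.one_mul, h, Complex.ofReal_re, ← mul_assoc, ← mul_assoc,
    eprAmp_mul_self, one_mul]

/-- If `S Tᵀ = 1`, then the gates `S` and `T` leave the EPR pairs invariant. -/
theorem Experiment.Simulates.hasEPRCorr {E : Experiment ιA ιB}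
    {S T : Matrix (Qubits n) (Qubits n) ℂ} (hST : S * Tᵀ = 1)
    (h : E.Simulates (refExperiment S T)) :
    HasEPRCorr E.measA E.measB (asMatrix E.state) := by
  intro a b
  rw [h.frob_jointObs, asMatrix_refExperiment, hST]
  exact frob_refJoint a b

end Statistics

/-! ### Equivalence of experiments -/

section Equivalence

variable {n : ℕ} {ιA : Fin n → Type u} {ιB : Fin n → Type v}
  [∀ w, Fintype (ιA w)] [∀ w, DecidableEq (ιA w)]
  [∀ w, Fintype (ιB w)] [∀ w, DecidableEq (ιB w)]

theorem asMatrix_junkTensor {α : Type u} {β : Type v} (junk : α × β → ℂ)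
    (φ : Qubits n × Qubits n → ℂ) :
    asMatrix (junkTensor junk φ) = asMatrix junk ⊗ₖ asMatrix φ := rfl

/-- The unit vector that belongs to the matrix `J` if `J ⊗ 1` is the normalized joint state. -/
noncomputable def junkState {α : Type u} {β : Type v} (n : ℕ) (J : Matrix α β ℂ) : α × β → ℂ :=
  fun p => ((Real.sqrt 2 ^ n : ℝ) : ℂ) * J p.1 p.2

theorem sqrt_two_pow_mul_eprAmp (n : ℕ) : Real.sqrt 2 ^ n * eprAmp n = 1 := by
  rw [eprAmp, ← mul_pow, mul_one_div_cancel (by positivity), one_pow]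

theorem asMatrix_junkState {α : Type u} {β : Type v} (n : ℕ) (J : Matrix α β ℂ) :
    asMatrix (junkState n J) = ((Real.sqrt 2 ^ n : ℝ) : ℂ) • J := rfl

theorem junkState_kronecker {α : Type u} {β : Type v} (J : Matrix α β ℂ)
    (S : Matrix (Qubits n) (Qubits n) ℂ) :
    asMatrix (junkState n J) ⊗ₖ ((eprAmp n : ℂ) • S) = J ⊗ₖ S := by
  rw [asMatrix_junkState, Matrix.smul_kronecker, Matrix.kronecker_smul, smul_smul,
    ← Complex.ofReal_mul, sqrt_two_pow_mul_eprAmp, Complex.ofReal_one, one_smul]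

theorem isState_junkState {α : Type u} {β : Type v} [Fintype α] [Fintype β] (J : Matrix α β ℂ)
    (h : frob (J ⊗ₖ (1 : Matrix (Qubits n) (Qubits n) ℂ))
      (J ⊗ₖ (1 : Matrix (Qubits n) (Qubits n) ℂ)) = 1) : IsState (junkState n J) := by
  rw [IsState, ← frob_self_eq_sum, asMatrix_junkState, frob_smul_left, frob_smul_right, ← h,
    ← mul_assoc, ← mul_pow, Real.mul_self_sqrt (by norm_num)]
  rw [frob, frob, Matrix.conjTranspose_kronecker, ← Matrix.mul_kronecker_mul,
    Matrix.trace_kronecker, Matrix.conjTranspose_one, Matrix.one_mul, Matrix.trace_one]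
  rw [card_qubits_cast, mul_comm, Complex.mul_re]
  simp only [Complex.ofReal_re, Complex.ofReal_im]
  ring

/-- Isometries that intertwine the observables of the two sides separately, and map the state to
`junk ⊗ (S ⊗ T) φ`, establish an equivalence of experiments. -/
theorem Experiment.equivalentVia_of_intertwine (E : Experiment ιA ιB)
    {ΦA : Matrix (Reg ιA × Qubits n) (Reg ιA) ℂ} {ΦB : Matrix (Reg ιB × Qubits n) (Reg ιB) ℂ}
    (hA : ΦAᴴ * ΦA = 1) (hB : ΦBᴴ * ΦB = 1) {S T : Matrix (Qubits n) (Qubits n) ℂ}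
    {J : Matrix (Reg ιA) (Reg ιB) ℂ}
    (hMA : ∀ a, ΦA * (jointObs E.measA a * asMatrix E.state) =
      ((1 : Matrix (Reg ιA) (Reg ιA) ℂ) ⊗ₖ refJoint a) * (ΦA * asMatrix E.state))
    (hMB : ∀ b, asMatrix E.state * (jointObs E.measB b)ᵀ * ΦBᵀ =
      asMatrix E.state * ΦBᵀ * ((1 : Matrix (Reg ιB) (Reg ιB) ℂ) ⊗ₖ refJoint b))
    (hJ : ΦA * asMatrix E.state * ΦBᵀ = J ⊗ₖ (S * Tᵀ)) :
    E.EquivalentVia (refExperiment S T) ΦA ΦB (junkState n J) where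
  isometryA := hA
  isometryB := hB
  map_state := by
    apply asMatrix_injective
    rw [asMatrix_kronecker_mulVec, asMatrix_junkTensor, asMatrix_refExperiment,
      junkState_kronecker, hJ]
  map_meas a b := by
    apply asMatrix_injective
    rw [asMatrix_kronecker_mulVec, asMatrix_junkTensor, Experiment.obs, Experiment.obs,
      asMatrix_kronecker_mulVec, asMatrix_kronecker_mulVec, asMatrix_refExperiment]
    change ΦA * (jointObs E.measA a * asMatrix E.state * (jointObs E.measB b)ᵀ) * ΦBᵀ =
      asMatrix (junkState n J) ⊗ₖ (refJoint a * ((eprAmp n : ℂ) • (S * Tᵀ)) * (refJoint b)ᵀ)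
    rw [Matrix.mul_smul, Matrix.smul_mul, junkState_kronecker, refJoint_transpose]
    calc ΦA * (jointObs E.measA a * asMatrix E.state * (jointObs E.measB b)ᵀ) * ΦBᵀ
        = ΦA * (jointObs E.measA a * (asMatrix E.state * (jointObs E.measB b)ᵀ * ΦBᵀ)) := by
          simp only [Matrix.mul_assoc]
      _ = ΦA * (jointObs E.measA a * asMatrix E.state) * ΦBᵀ *
            ((1 : Matrix (Reg ιB) (Reg ιB) ℂ) ⊗ₖ refJoint b) := by
          rw [hMB]
          simp only [Matrix.mul_assoc]
      _ = ((1 : Matrix (Reg ιA) (Reg ιA) ℂ) ⊗ₖ refJoint a) * (J ⊗ₖ (S * Tᵀ)) *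
            ((1 : Matrix (Reg ιB) (Reg ιB) ℂ) ⊗ₖ refJoint b) := by
          rw [hMA, ← hJ]
          simp only [Matrix.mul_assoc]
      _ = J ⊗ₖ (refJoint a * (S * Tᵀ) * refJoint b) := by
          rw [← Matrix.mul_kronecker_mul, ← Matrix.mul_kronecker_mul, Matrix.one_mul,
            Matrix.mul_one]

theorem kronecker_mulVec_tensorVec {α α' β β' : Type*} [Fintype α] [Fintype β]
    (A : Matrix α' α ℂ) (B : Matrix β' β ℂ) (v : α → ℂ) (x : β → ℂ) :
    (A ⊗ₖ B) *ᵥ tensorVec v x = tensorVec (A *ᵥ v) (B *ᵥ x) := by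
  ext ⟨i, j⟩
  simp only [Matrix.mulVec, dotProduct, tensorVec, Matrix.kroneckerMap_apply,
    Fintype.sum_prod_type, Finset.sum_mul_sum]
  exact Finset.sum_congr rfl fun _ _ => Finset.sum_congr rfl fun _ _ => by ring

/-- An operator identity on `J ⊗ 1` is an identity on all `v ⊗ x` with `v` in the support. -/
theorem mulVec_tensorVec_eq_of_mem_supportA {α : Type u} {β : Type v} [Fintype α] [DecidableEq α]
    [Fintype β] [DecidableEq β] {J : Matrix α β ℂ}
    {K K' : Matrix (α × Qubits n) (α × Qubits n) ℂ}
    (h : K * (J ⊗ₖ (1 : Matrix (Qubits n) (Qubits n) ℂ)) =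
      K' * (J ⊗ₖ (1 : Matrix (Qubits n) (Qubits n) ℂ)))
    {v : α → ℂ} (hv : v ∈ supportA (junkState n J)) (x : Qubits n → ℂ) :
    K *ᵥ tensorVec v x = K' *ᵥ tensorVec v x := by
  induction hv using Submodule.span_induction with
  | mem v hv =>
    obtain ⟨b, rfl⟩ := hv
    have hb : tensorVec (fun a => junkState n J (a, b)) x =
        (J ⊗ₖ (1 : Matrix (Qubits n) (Qubits n) ℂ)) *ᵥ
          tensorVec (Pi.single b (((Real.sqrt 2 ^ n : ℝ) : ℂ))) x := by
      rw [kronecker_mulVec_tensorVec, Matrix.one_mulVec]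
      congr 1
      ext a
      simp [junkState, mul_comm]
    change K *ᵥ tensorVec (fun a => junkState n J (a, b)) x =
      K' *ᵥ tensorVec (fun a => junkState n J (a, b)) x
    rw [hb, Matrix.mulVec_mulVec, Matrix.mulVec_mulVec, h]
  | zero =>
    have : tensorVec (0 : α → ℂ) x = 0 := by
      ext p
      simp [tensorVec]
    rw [this, Matrix.mulVec_zero, Matrix.mulVec_zero]
  | add v v' _ _ hv hv' =>
    have : tensorVec (v + v') x = tensorVec v x + tensorVec v' x := by
      ext p
      simp [tensorVec, add_mul]
    rw [this, Matrix.mulVec_add, Matrix.mulVec_add, hv, hv']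
  | smul c v _ hv =>
    have : tensorVec (c • v) x = c • tensorVec v x := by
      ext p
      simp [tensorVec, mul_assoc]
    rw [this, Matrix.mulVec_smul, Matrix.mulVec_smul, hv]

end Equivalence

/-! ### Aligning the isometries -/

section Align

variable {n : ℕ}

theorem kronecker_mul_isometry {α κ : Type*} [Fintype α] [DecidableEq α] [Fintype κ]
    [DecidableEq κ] {W : Matrix α α ℂ} (hW : W ∈ Matrix.unitaryGroup α ℂ)
    {Φ : Matrix (α × Qubits n) κ ℂ} (hΦ : Φᴴ * Φ = 1) :
    ((Wᴴ ⊗ₖ (1 : Matrix (Qubits n) (Qubits n) ℂ)) * Φ)ᴴ *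
      ((Wᴴ ⊗ₖ (1 : Matrix (Qubits n) (Qubits n) ℂ)) * Φ) = 1 := by
  have hWW : W * Wᴴ = 1 := Matrix.mem_unitaryGroup_iff.1 hW
  rw [Matrix.conjTranspose_mul, Matrix.conjTranspose_kronecker, Matrix.conjTranspose_conjTranspose,
    Matrix.conjTranspose_one, Matrix.mul_assoc, ← Matrix.mul_assoc (W ⊗ₖ _),
    ← Matrix.mul_kronecker_mul, hWW, Matrix.one_mul, Matrix.one_kronecker_one, Matrix.one_mul, hΦ]

/-- A unitary on the junk system does not disturb the intertwining relations. -/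
theorem kronecker_mul_intertwine {α κ : Type*} [Fintype α] [DecidableEq α]
    (W : Matrix α α ℂ) {R : Matrix (Qubits n) (Qubits n) ℂ}
    {A B : Matrix (α × Qubits n) κ ℂ} (h : A = ((1 : Matrix α α ℂ) ⊗ₖ R) * B) :
    (W ⊗ₖ (1 : Matrix (Qubits n) (Qubits n) ℂ)) * A =
      ((1 : Matrix α α ℂ) ⊗ₖ R) * ((W ⊗ₖ (1 : Matrix (Qubits n) (Qubits n) ℂ)) * B) := by
  rw [h, ← Matrix.mul_assoc, ← Matrix.mul_assoc, ← Matrix.mul_kronecker_mul,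
    ← Matrix.mul_kronecker_mul, Matrix.one_mul, Matrix.one_mul, Matrix.mul_one, Matrix.mul_one]

variable {ιA : Fin n → Type u} {ιB : Fin n → Type v}
  [∀ w, Fintype (ιA w)] [∀ w, DecidableEq (ιA w)]
  [∀ w, Fintype (ιB w)] [∀ w, DecidableEq (ιB w)]

/-- The three experiments are brought to the standard form by four local isometries with a common
junk vector. The isometries of the second devices are the swap isometries, followed by the
unitaries on the junk systems that relate the junk vectors of the three experiments. -/
theorem exists_aligned_isometries {Ψ : Matrix (Reg ιA) (Reg ιB) ℂ}
    {M₁ M₂ : ∀ w, MeasDevice (ιA w)} {N₁ N₂ : ∀ w, MeasDevice (ιB w)}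
    {T : Matrix (Qubits n) (Qubits n) ℂ} (hT : IsAdmissibleGate T)
    {G : Matrix (Reg ιA) (Reg ιA) ℂ} (hG : Gᴴ * G = 1)
    {H : Matrix (Reg ιB) (Reg ιB) ℂ} (hH : Hᴴ * H = 1)
    (h₁ : HasEPRCorr M₁ N₁ Ψ) (h₂ : HasEPRCorr M₂ N₂ (G * Ψ * Hᵀ))
    (hcorr : ∀ a b, frob (G * Ψ) (jointObs M₂ a * (G * Ψ) * (jointObs N₁ b)ᵀ) =
      frob ((eprAmp n : ℂ) • T) (refJoint a * ((eprAmp n : ℂ) • T) * (refJoint b)ᵀ)) :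
    ∃ (ΦA ΦA' : Matrix (Reg ιA × Qubits n) (Reg ιA) ℂ)
      (ΦB ΦB' : Matrix (Reg ιB × Qubits n) (Reg ιB) ℂ) (J : Matrix (Reg ιA) (Reg ιB) ℂ),
      (ΦAᴴ * ΦA = 1 ∧ ΦA'ᴴ * ΦA' = 1 ∧ ΦBᴴ * ΦB = 1 ∧ ΦB'ᴴ * ΦB' = 1) ∧
      (∀ a, ΦA * (jointObs M₁ a * Ψ) =
        ((1 : Matrix (Reg ιA) (Reg ιA) ℂ) ⊗ₖ refJoint a) * (ΦA * Ψ)) ∧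
      (∀ a, ΦA' * (jointObs M₂ a * (G * Ψ)) =
        ((1 : Matrix (Reg ιA) (Reg ιA) ℂ) ⊗ₖ refJoint a) * (ΦA' * (G * Ψ))) ∧
      (∀ b, Ψ * (jointObs N₁ b)ᵀ * ΦBᵀ =
        Ψ * ΦBᵀ * ((1 : Matrix (Reg ιB) (Reg ιB) ℂ) ⊗ₖ refJoint b)) ∧
      (∀ b, G * Ψ * Hᵀ * (jointObs N₂ b)ᵀ * ΦB'ᵀ =
        G * Ψ * Hᵀ * ΦB'ᵀ * ((1 : Matrix (Reg ιB) (Reg ιB) ℂ) ⊗ₖ refJoint b)) ∧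
      ΦA * Ψ * ΦBᵀ = J ⊗ₖ (1 : Matrix (Qubits n) (Qubits n) ℂ) ∧
      ΦA' * (G * Ψ * Hᵀ) * ΦB'ᵀ = J ⊗ₖ (1 : Matrix (Qubits n) (Qubits n) ℂ) ∧
      ΦA' * (G * Ψ) * ΦBᵀ = J ⊗ₖ T := by
  have hHT : Hᵀ * Hᵀᴴ = 1 := transpose_mul_conjTranspose_transpose hH
  -- The relations of the second device on side `A` do not involve the gate on side `B`.
  have hM₂ : ∀ a, swapIsometry M₂ * (jointObs M₂ a * (G * Ψ)) =
      ((1 : Matrix (Reg ιA) (Reg ιA) ℂ) ⊗ₖ refJoint a) * (swapIsometry M₂ * (G * Ψ)) := by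
    intro a
    have := congrArg (· * Hᵀᴴ) (h₂.swapIsometry_mul a)
    simpa only [Matrix.mul_assoc, hHT, Matrix.mul_one] using this
  obtain ⟨J, hJ⟩ := h₁.exists_junk
  obtain ⟨J₂, hJ₂⟩ := h₂.exists_junk
  obtain ⟨J₃, hJ₃⟩ := h₁.exists_junk_gate hT hG hM₂ hcorr
  have hA := swapIsometry_isometry M₁
  have hA' := swapIsometry_isometry M₂
  have hB := swapIsometry_isometry N₁
  have hB' := swapIsometry_isometry N₂
  have hN₂ := h₂.transpose.swapIsometry_mul
  generalize swapIsometry N₂ = ΦB' at *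
  have hAG : (swapIsometry M₂ * G)ᴴ * (swapIsometry M₂ * G) = 1 := by
    rw [Matrix.conjTranspose_mul, Matrix.mul_assoc, ← Matrix.mul_assoc (swapIsometry M₂)ᴴ, hA',
      Matrix.one_mul, hG]
  have hBH : (ΦB' * H)ᴴ * (ΦB' * H) = 1 := by
    rw [Matrix.conjTranspose_mul, Matrix.mul_assoc, ← Matrix.mul_assoc ΦB'ᴴ, hB',
      Matrix.one_mul, hH]
  have h1 : (1 : Matrix (Qubits n) (Qubits n) ℂ)ᴴ * (1 : Matrix (Qubits n) (Qubits n) ℂ) = 1 := by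
    simp
  obtain ⟨W, hW, hJW⟩ := exists_unitary_mul_eq_of_kronecker hAG hA hT.conjTranspose_mul h1
    (P := Ψ * (swapIsometry N₁)ᵀ) (by rw [← hJ₃]; simp only [Matrix.mul_assoc])
    (by rw [← hJ]; simp only [Matrix.mul_assoc])
  have hWW : Wᴴ * W = 1 := Matrix.mem_unitaryGroup_iff'.1 hW
  let ΦA' := (Wᴴ ⊗ₖ (1 : Matrix (Qubits n) (Qubits n) ℂ)) * swapIsometry M₂
  have f₃ : ΦA' * (G * Ψ) * (swapIsometry N₁)ᵀ = J ⊗ₖ T := by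
    rw [Matrix.mul_assoc, Matrix.mul_assoc _ (swapIsometry M₂),
      ← Matrix.mul_assoc (swapIsometry M₂),
      hJ₃, ← Matrix.mul_kronecker_mul, hJW, ← Matrix.mul_assoc, hWW, Matrix.one_mul, Matrix.one_mul]
  have f₂ : ΦA' * (G * Ψ * Hᵀ) * ΦB'ᵀ =
      (Wᴴ * J₂) ⊗ₖ (1 : Matrix (Qubits n) (Qubits n) ℂ) := by
    rw [Matrix.mul_assoc, Matrix.mul_assoc _ (swapIsometry M₂),
      ← Matrix.mul_assoc (swapIsometry M₂),
      hJ₂, ← Matrix.mul_kronecker_mul, Matrix.one_mul]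
  have hTt : Tᵀᴴ * Tᵀ = 1 := by
    rw [hT.transpose_eq, Matrix.conjTranspose_conjTranspose, hT.mul_conjTranspose]
  obtain ⟨V, hV, hJV⟩ := exists_unitary_mul_eq_of_kronecker hBH hB h1 hTt
    (P := (ΦA' * (G * Ψ))ᵀ) (J := (Wᴴ * J₂)ᵀ) (J' := Jᵀ)
    (by
      have := congrArg Matrix.transpose f₂
      rw [← Matrix.kroneckerMap_transpose, Matrix.transpose_one] at this
      rw [← this]
      simp only [Matrix.transpose_mul, Matrix.transpose_transpose, Matrix.mul_assoc])
    (by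
      have := congrArg Matrix.transpose f₃
      rw [← Matrix.kroneckerMap_transpose] at this
      rw [← this]
      simp only [Matrix.transpose_mul, Matrix.transpose_transpose])
  have hVV : Vᵀ * Vᵀᴴ = 1 :=
    transpose_mul_conjTranspose_transpose (Matrix.mem_unitaryGroup_iff'.1 hV)
  have hJV' : Wᴴ * J₂ = J * Vᵀ := by
    simpa only [Matrix.transpose_mul, Matrix.transpose_transpose] using
      congrArg Matrix.transpose hJV
  refine ⟨swapIsometry M₁, ΦA', swapIsometry N₁,
    (Vᴴ ⊗ₖ (1 : Matrix (Qubits n) (Qubits n) ℂ)) * ΦB', J,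
    ⟨hA, kronecker_mul_isometry hW hA', hB, kronecker_mul_isometry hV hB'⟩, h₁.swapIsometry_mul,
    ?_, h₁.mul_swapIsometry_transpose, ?_, hJ, ?_, f₃⟩
  · intro a
    rw [Matrix.mul_assoc, Matrix.mul_assoc]
    exact kronecker_mul_intertwine Wᴴ (hM₂ a)
  · intro b
    have := congrArg Matrix.transpose (kronecker_mul_intertwine Vᴴ (hN₂ b))
    simp only [Matrix.transpose_mul, Matrix.transpose_transpose,
      one_kronecker_refJoint_transpose, Matrix.mul_assoc] at this ⊢
    exact this
  · rw [Matrix.transpose_mul, ← Matrix.mul_assoc, f₂, hJV', ← Matrix.kroneckerMap_transpose,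
      Matrix.transpose_one, ← Matrix.mul_kronecker_mul, Matrix.mul_assoc, Matrix.mul_one]
    rw [show Vᴴᵀ = Vᵀᴴ from rfl, hVV, Matrix.mul_one]

end Align

end GateSelfTest

theorem mainTheorem3 {n : ℕ} (T : Matrix (Qubits n) (Qubits n) ℂ) (hT : IsReferenceGate n T)
    {ιA : Fin n → Type*} {ιB : Fin n → Type*}
    [∀ w, Fintype (ιA w)] [∀ w, DecidableEq (ιA w)]
    [∀ w, Fintype (ιB w)] [∀ w, DecidableEq (ιB w)]
    (ψ : Reg ιA × Reg ιB → ℂ) (hψ : IsState ψ)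
    (G : Matrix (Reg ιA) (Reg ιA) ℂ) (hG : G ∈ Matrix.unitaryGroup (Reg ιA) ℂ)
    (H : Matrix (Reg ιB) (Reg ιB) ℂ) (hH : H ∈ Matrix.unitaryGroup (Reg ιB) ℂ)
    (M₁ M₂ : ∀ w, MeasDevice (ιA w)) (N₁ N₂ : ∀ w, MeasDevice (ιB w))
    (E₁ E₂ E₃ : Experiment ιA ιB)
    (hE₁ : E₁ = { state := ψ, measA := M₁, measB := N₁ })
    (hE₂ : E₂ = { state := (G ⊗ₖ H) *ᵥ ψ, measA := M₂, measB := N₂ })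
    (hE₃ : E₃ = { state := (G ⊗ₖ (1 : Matrix (Reg ιB) (Reg ιB) ℂ)) *ᵥ ψ,
                  measA := M₂, measB := N₁ })
    (sim₁ : E₁.Simulates (refExperiment 1 1))
    (sim₂ : E₂.Simulates (refExperiment T T))
    (sim₃ : E₃.Simulates (refExperiment T 1)) :
    ∃ UA ∈ Matrix.unitaryGroup (Reg ιA × Qubits n) ℂ,
    ∃ UB ∈ Matrix.unitaryGroup (Reg ιB × Qubits n) ℂ,
    ∃ VA ∈ Matrix.unitaryGroup (Reg ιA × Qubits n) ℂ,
    ∃ VB ∈ Matrix.unitaryGroup (Reg ιB × Qubits n) ℂ,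
    ∃ junk : Reg ιA × Reg ιB → ℂ, IsState junk ∧
      E₁.EquivalentWith (refExperiment 1 1) UA UB junk ∧
      E₂.EquivalentWith (refExperiment T T) VA VB junk ∧
      E₃.EquivalentWith (refExperiment T 1) VA UB junk ∧
      ∀ v ∈ supportA junk, ∀ x : Qubits n → ℂ,
        (VA * (G ⊗ₖ (1 : Matrix (Qubits n) (Qubits n) ℂ)) * UAᴴ) *ᵥ tensorVec v x =
          ((1 : Matrix (Reg ιA) (Reg ιA) ℂ) ⊗ₖ T) *ᵥ tensorVec v x := by
  subst hE₁ hE₂ hE₃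
  have gate := hT.isAdmissibleGate
  have hTT : T * Tᵀ = 1 := by rw [gate.transpose_eq, gate.mul_conjTranspose]
  have e₂ : asMatrix ((G ⊗ₖ H) *ᵥ ψ) = G * asMatrix ψ * Hᵀ := asMatrix_kronecker_mulVec _ _ _
  have e₃ : asMatrix ((G ⊗ₖ (1 : Matrix (Reg ιB) (Reg ιB) ℂ)) *ᵥ ψ) = G * asMatrix ψ := by
    rw [asMatrix_kronecker_mulVec, Matrix.transpose_one, Matrix.mul_one]
  have h₁ : HasEPRCorr M₁ N₁ (asMatrix ψ) := by
    have := sim₁.hasEPRCorr (by simp)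
    exact this
  have h₂ : HasEPRCorr M₂ N₂ (G * asMatrix ψ * Hᵀ) := by
    have := sim₂.hasEPRCorr hTT
    rwa [e₂] at this
  have hcorr : ∀ a b : Fin n → Setting, frob (G * asMatrix ψ)
      (jointObs M₂ a * (G * asMatrix ψ) * (jointObs N₁ b)ᵀ) =
      frob ((eprAmp n : ℂ) • T) (refJoint a * ((eprAmp n : ℂ) • T) * (refJoint b)ᵀ) := by
    intro a b
    have := sim₃.frob_jointObs a b
    rw [asMatrix_refExperiment, Matrix.transpose_one, Matrix.mul_one] at this
    rw [← e₃]
    exact this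
  obtain ⟨ΦA, ΦA', ΦB, ΦB', J, ⟨iA, iA', iB, iB'⟩, tA, tA', tB, tB', f₁, f₂, f₃⟩ :=
    exists_aligned_isometries gate (Matrix.mem_unitaryGroup_iff'.1 hG)
      (Matrix.mem_unitaryGroup_iff'.1 hH) h₁ h₂ hcorr
  obtain ⟨UA, hUA, rfl⟩ := exists_unitary_mul_ancilla iA
  obtain ⟨VA, hVA, rfl⟩ := exists_unitary_mul_ancilla iA'
  obtain ⟨UB, hUB, rfl⟩ := exists_unitary_mul_ancilla iB
  obtain ⟨VB, hVB, rfl⟩ := exists_unitary_mul_ancilla iB'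
  refine ⟨UA, hUA, UB, hUB, VA, hVA, VB, hVB, junkState n J, ?_, ?_, ?_, ?_, ?_⟩
  · apply isState_junkState
    rw [← f₁, frob_mul_transpose_isometry iB, frob_isometry_mul iA, h₁.norm]
  · exact Experiment.equivalentVia_of_intertwine _ iA iB tA tB (by simpa using f₁)
  · refine Experiment.equivalentVia_of_intertwine _ iA' iB' ?_ ?_ ?_
    · intro a
      change _ * (jointObs M₂ a * asMatrix ((G ⊗ₖ H) *ᵥ ψ)) = _ * (_ * asMatrix ((G ⊗ₖ H) *ᵥ ψ))
      rw [e₂, ← Matrix.mul_assoc (jointObs M₂ a), ← Matrix.mul_assoc (VA * ancilla _ n), tA' a]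
      simp only [Matrix.mul_assoc]
    · intro b
      change asMatrix ((G ⊗ₖ H) *ᵥ ψ) * (jointObs N₂ b)ᵀ * _ = asMatrix ((G ⊗ₖ H) *ᵥ ψ) * _ * _
      rw [e₂, tB' b]
    · rw [hTT, ← f₂, ← e₂]
  · refine Experiment.equivalentVia_of_intertwine _ iA' iB ?_ ?_ ?_
    · intro a
      change _ * (jointObs M₂ a * asMatrix ((G ⊗ₖ 1) *ᵥ ψ)) = _ * (_ * asMatrix ((G ⊗ₖ 1) *ᵥ ψ))
      rw [e₃, tA' a]
    · intro b
      change asMatrix ((G ⊗ₖ 1) *ᵥ ψ) * (jointObs N₁ b)ᵀ * _ = asMatrix ((G ⊗ₖ 1) *ᵥ ψ) * _ * _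
      rw [e₃, Matrix.mul_assoc, Matrix.mul_assoc, ← Matrix.mul_assoc (asMatrix ψ), tB b]
      simp only [Matrix.mul_assoc]
    · rw [Matrix.transpose_one, Matrix.mul_one, ← f₃, ← e₃]
  · intro v hv x
    refine mulVec_tensorVec_eq_of_mem_supportA ?_ hv x
    -- `J ⊗ 1` lies in the range of the first isometry, on which `UAᴴ` undoes `UA`.
    have hUU : UAᴴ * UA = 1 := Matrix.mem_unitaryGroup_iff'.1 hUA
    rw [← Matrix.mul_kronecker_mul, Matrix.one_mul, Matrix.mul_one, ← f₃, ← f₁]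
    calc VA * (G ⊗ₖ (1 : Matrix (Qubits n) (Qubits n) ℂ)) * UAᴴ *
          (UA * ancilla (Reg ιA) n * asMatrix ψ * (UB * ancilla (Reg ιB) n)ᵀ)
        = VA * (G ⊗ₖ (1 : Matrix (Qubits n) (Qubits n) ℂ)) * (UAᴴ * UA) *
            (ancilla (Reg ιA) n * (asMatrix ψ * (UB * ancilla (Reg ιB) n)ᵀ)) := by
          simp only [Matrix.mul_assoc]
      _ = VA * ((G ⊗ₖ (1 : Matrix (Qubits n) (Qubits n) ℂ)) * ancilla (Reg ιA) n) *
            (asMatrix ψ * (UB * ancilla (Reg ιB) n)ᵀ) := by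
          rw [hUU, Matrix.mul_one]
          simp only [Matrix.mul_assoc]
      _ = _ := by
          rw [kronecker_one_mul_ancilla]
          simp only [Matrix.mul_assoc]
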